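/- Let $n,m\ge 1$ be integers and let $\alpha>0$ be real. On $\mathbb{C}^n$ write $\langle z,w\rangle=\sum_{r=1}^n z_r\overline{w_r}$ and $|z|=\sqrt{\langle z,z\rangle}$. A smooth function $f\colon\mathbb{C}^n\to\mathbb{C}$ is called $m$-analytic if $\overline{D}^k f=0$ for every multiindex $k\in\mathbb{N}_0^n$ with $|k|=k_1+\cdots+k_n=m$, where $\overline{D}^k=\partial_{\overline{z}_1}^{k_1}\cdots\partial_{\overline{z}_n}^{k_n}$ is the Wirtinger operator. Let $\mathcal{F}_{\alpha,m}$ be the space of all $m$-analytic functions $f$ on $\mathbb{C}^n$ such that $$\|f\|_{\mathcal{F}_{\alpha,m}}=\left(\frac{\alpha^n}{\pi^n}\int_{\mathbb{C}^n}|f(z)|^2 e^{-\alpha|z|^2}\,d\mu_{2n}(z)\right)^{1/2}<\infty,$$ with the corresponding inner product, where $\mu_{2n}$ is Lebesgue measure. For integers $a,p\ge 0$ let $L_p^{(a)}(x)=\sum_{i=0}^p(-1)^i\binom{p+a}{p-i}\frac{x^i}{i!}$ be the generalized Laguerre polynomial, $L_p=L_p^{(0)}$, and $\ell_p(t)=e^{-t/2}L_p(t)$.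 Put $J_{n,m}=\{k\in\mathbb{N}_0^n: |k|\le m-1\}$ and $d_{n,m}=\#J_{n,m}$. Then $\mathcal{F}_{\alpha,m}$ is a reproducing kernel Hilbert space (it is complete and all point evaluations are bounded), $d_{n,m}=\binom{n+m-1}{n}$, and for all $z,w\in\mathbb{C}^n$ the reproducing kernel $K_z=K_z^{\mathcal{F}_{\alpha,m}}$ satisfies $$K_z(w)=e^{\alpha\langle w,z\rangle}L_{m-1}^{(n)}(\alpha|w-z|^2),\qquad \|K_z\|_{\mathcal{F}_{\alpha,m}}=\sqrt{d_{n,m}}\;e^{\frac{\alpha}{2}|z|^2},$$ $$K_z(w)=\sum_{k\in J_{n,m}}\prod_{r=1}^n e^{\alpha w_r\overline{z_r}}L_{k_r}(\alpha|w_r-z_r|^2),$$ $$K_z(w)=\sum_{k\in J_{n,m}}\prod_{r=1}^n e^{\frac{\alpha}{2}(|w_r|^2+|z_r|^2)+i\alpha\operatorname{Im}(w_r\overline{z_r})}\,\ell_{k_r}(\alpha|w_r-z_r|^2).$$ -/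

import Mathlib

noncomputable section

namespace PolyFockSpace

open MeasureTheory Complex
open scoped ContDiff

/-- The space `ℂⁿ` with its Euclidean norm. -/
abbrev Cn (n : ℕ) : Type := EuclideanSpace ℂ (Fin n)

/-- The Wirtinger derivative `∂f/∂z̄_j = (∂f/∂x_j + i ∂f/∂y_j) / 2`. -/
def wirtingerBar {n : ℕ} (j : Fin n) (f : Cn n → ℂ) (z : Cn n) : ℂ :=
  (1 / 2 : ℂ) * (fderiv ℝ f z (EuclideanSpace.single j (1 : ℂ))
    + I * fderiv ℝ f z (EuclideanSpace.single j I))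

/-- The operator `D̄ᵏ = (∂/∂z̄_1)^{k_1} ⋯ (∂/∂z̄_n)^{k_n}` for a multiindex `k`. -/
def wirtingerBarPow {n : ℕ} (k : Fin n → ℕ) (f : Cn n → ℂ) : Cn n → ℂ :=
  (List.finRange n).foldr (fun j g => (wirtingerBar j)^[k j] g) f

/-- Smooth (in the real sense) functions on `ℂⁿ` with `D̄ᵏ f = 0` for all `|k| = m`. -/
def IsMAnalytic {n : ℕ} (m : ℕ) (f : Cn n → ℂ) : Prop :=
  ContDiff ℝ ∞ f ∧ ∀ k : Fin n → ℕ, ∑ r, k r = m → ∀ z, wirtingerBarPow k f z = 0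

/-- The density `(αⁿ / πⁿ) exp(-α |z|²)`. -/
def gaussWeight (n : ℕ) (α : ℝ) (z : Cn n) : ℝ :=
  α ^ n / Real.pi ^ n * Real.exp (-α * ‖z‖ ^ 2)

/-- The Gaussian measure `(αⁿ / πⁿ) exp(-α |z|²) dμ_{2n}(z)` on `ℂⁿ`. -/
def gaussMeasure (n : ℕ) (α : ℝ) : Measure (Cn n) :=
  volume.withDensity fun z => ENNReal.ofReal (gaussWeight n α z)

/-- The multiindices `k ∈ ℕ₀ⁿ` with `|k| ≤ m - 1` (for `m ≥ 1`). -/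
def J (n m : ℕ) : Finset (Fin n → ℕ) :=
  (Fintype.piFinset fun _ => Finset.range m).filter fun k => ∑ r, k r < m

theorem mem_J {n m : ℕ} (hm : 1 ≤ m) (k : Fin n → ℕ) : k ∈ J n m ↔ ∑ r, k r ≤ m - 1 := by
  have h : ∀ r, k r ≤ ∑ s, k s := fun r =>
    Finset.single_le_sum (f := k) (fun _ _ => Nat.zero_le _) (Finset.mem_univ r)
  simp only [J, Finset.mem_filter, Fintype.mem_piFinset, Finset.mem_range]
  constructor
  · rintro ⟨-, h2⟩
    omega
  · intro h2
    exact ⟨fun r => by have := h r; omega, by omega⟩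

/-- The generalized Laguerre polynomial `L_p^{(a)}(x) = ∑ᵢ (-1)ⁱ C(p+a, p-i) xⁱ / i!`. -/
def laguerre (a p : ℕ) (x : ℝ) : ℝ :=
  ∑ i ∈ Finset.range (p + 1),
    (-1 : ℝ) ^ i * ((p + a).choose (p - i) : ℝ) * x ^ i / (i.factorial : ℝ)

/-- The Laguerre function `ℓ_p(t) = e^{-t/2} L_p(t)`, where `L_p = L_p^{(0)}`. -/
def laguerreFun (p : ℕ) (t : ℝ) : ℝ := Real.exp (-(1 / 2) * t) * laguerre 0 p t

/-! ### Linearity of the Wirtinger operators on smooth functions -/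

theorem wirtingerBar_contDiff {n : ℕ} (j : Fin n) {f : Cn n → ℂ} (hf : ContDiff ℝ ∞ f) :
    ContDiff ℝ ∞ (wirtingerBar j f) := by
  have h : ContDiff ℝ ∞ (fderiv ℝ f) := hf.fderiv_right (by simp)
  unfold wirtingerBar
  exact contDiff_const.mul ((h.clm_apply contDiff_const).add
    (contDiff_const.mul (h.clm_apply contDiff_const)))

theorem wirtingerBar_lin {n : ℕ} (j : Fin n) {f g : Cn n → ℂ} (hf : ContDiff ℝ ∞ f)
    (hg : ContDiff ℝ ∞ g) (c : ℂ) :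
    wirtingerBar j (f + c • g) = wirtingerBar j f + c • wirtingerBar j g := by
  funext z
  have hf' : DifferentiableAt ℝ f z := (hf.differentiable (by simp)) z
  have hg' : DifferentiableAt ℝ g z := (hg.differentiable (by simp)) z
  have e : fderiv ℝ (f + c • g) z = fderiv ℝ f z + c • fderiv ℝ g z := by
    rw [fderiv_add hf' (hg'.const_smul c), fderiv_const_smul hg']
  simp only [wirtingerBar, e, Pi.add_apply, Pi.smul_apply, add_apply, smul_apply, smul_eq_mul]
  ring

theorem wirtingerBar_iterate {n : ℕ} (j : Fin n) (p : ℕ) {f g : Cn n → ℂ} (c : ℂ)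
    (hf : ContDiff ℝ ∞ f) (hg : ContDiff ℝ ∞ g) :
    ContDiff ℝ ∞ ((wirtingerBar j)^[p] f) ∧
      (wirtingerBar j)^[p] (f + c • g) = (wirtingerBar j)^[p] f + c • (wirtingerBar j)^[p] g := by
  induction p generalizing f g with
  | zero => exact ⟨hf, rfl⟩
  | succ p ih =>
    simp only [Function.iterate_succ, Function.comp_apply]
    rw [wirtingerBar_lin j hf hg]
    exact ih (wirtingerBar_contDiff j hf) (wirtingerBar_contDiff j hg)

theorem wirtingerBarPow_lin {n : ℕ} (k : Fin n → ℕ) {f g : Cn n → ℂ} (c : ℂ)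
    (hf : ContDiff ℝ ∞ f) (hg : ContDiff ℝ ∞ g) :
    wirtingerBarPow k (f + c • g) = wirtingerBarPow k f + c • wirtingerBarPow k g := by
  unfold wirtingerBarPow
  suffices h : ∀ l : List (Fin n),
      ContDiff ℝ ∞ (l.foldr (fun j g => (wirtingerBar j)^[k j] g) f) ∧
      ContDiff ℝ ∞ (l.foldr (fun j g => (wirtingerBar j)^[k j] g) g) ∧
      l.foldr (fun j g => (wirtingerBar j)^[k j] g) (f + c • g) =
        l.foldr (fun j g => (wirtingerBar j)^[k j] g) f +
          c • l.foldr (fun j g => (wirtingerBar j)^[k j] g) g from (h _).2.2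
  intro l
  induction l with
  | nil => exact ⟨hf, hg, rfl⟩
  | cons j l ih =>
    obtain ⟨h1, h2, h3⟩ := ih
    simp only [List.foldr_cons]
    rw [h3]
    exact ⟨(wirtingerBar_iterate j (k j) c h1 h2).1, (wirtingerBar_iterate j (k j) c h2 h2).1,
      (wirtingerBar_iterate j (k j) c h1 h2).2⟩

theorem IsMAnalytic.lin {n m : ℕ} {f g : Cn n → ℂ} (hf : IsMAnalytic m f)
    (hg : IsMAnalytic m g) (c : ℂ) : IsMAnalytic m (f + c • g) := by
  refine ⟨hf.1.add (hg.1.const_smul c), fun k hk z => ?_⟩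
  rw [wirtingerBarPow_lin k c hf.1 hg.1]
  simp [hf.2 k hk z, hg.2 k hk z]

theorem IsMAnalytic.zero {n m : ℕ} : IsMAnalytic m (0 : Cn n → ℂ) := by
  refine ⟨contDiff_const, fun k _ z => ?_⟩
  have h := wirtingerBarPow_lin k (f := (0 : Cn n → ℂ)) (g := 0) (-1) contDiff_const contDiff_const
  simp only [smul_zero, add_zero, neg_smul, one_smul, add_neg_cancel] at h
  simp [h]

/-! ### The `m`-analytic Bargmann-Segal-Fock space -/

/-- The vector space of all `m`-analytic functions on `ℂⁿ` that are square integrable with respect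
to the Gaussian measure. -/
def polyFockSubmodule (n m : ℕ) (α : ℝ) : Submodule ℂ (Cn n → ℂ) where
  carrier := {f | IsMAnalytic m f ∧ MemLp f 2 (gaussMeasure n α)}
  zero_mem' := ⟨IsMAnalytic.zero, MemLp.zero⟩
  add_mem' {f g} hf hg := ⟨by simpa using hf.1.lin hg.1 1, hf.2.add hg.2⟩
  smul_mem' c f hf := ⟨by simpa using IsMAnalytic.zero.lin hf.1 c, hf.2.const_smul c⟩

/-- The `m`-analytic Bargmann-Segal-Fock space over `ℂⁿ` with parameter `α > 0`. -/
def PolyFock (n m : ℕ) (α : ℝ) (_hα : 0 < α) : Type := polyFockSubmodule n m α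

variable {n m : ℕ} {α : ℝ} {hα : 0 < α}

instance : AddCommGroup (PolyFock n m α hα) :=
  inferInstanceAs (AddCommGroup (polyFockSubmodule n m α))

instance : Module ℂ (PolyFock n m α hα) :=
  inferInstanceAs (Module ℂ (polyFockSubmodule n m α))

/-- The underlying function of an element of the space. -/
def PolyFock.toFun (f : PolyFock n m α hα) : Cn n → ℂ := Subtype.val f

theorem PolyFock.memLp (f : PolyFock n m α hα) : MemLp f.toFun 2 (gaussMeasure n α) :=
  (Subtype.property f).2

theorem PolyFock.continuous (f : PolyFock n m α hα) : Continuous f.toFun :=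
  (Subtype.property f).1.1.continuous

theorem gaussWeight_pos (hα : 0 < α) (z : Cn n) : 0 < gaussWeight n α z := by
  unfold gaussWeight
  have := Real.pi_pos
  positivity

theorem gaussWeight_continuous : Continuous (gaussWeight n α) := by
  unfold gaussWeight
  fun_prop

theorem gaussMeasure_ae (hα : 0 < α) {p : Cn n → Prop} (h : ∀ᵐ z ∂gaussMeasure n α, p z) :
    ∀ᵐ z, p z := by
  refine (withDensity_absolutelyContinuous' ?_ ?_).ae_le h
  · exact (ENNReal.continuous_ofReal.comp gaussWeight_continuous).measurable.aemeasurable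
  · exact Filter.Eventually.of_forall fun z => by
      simpa using gaussWeight_pos hα z

/-- The inner product `∫ conj (f z) g z (αⁿ / πⁿ) exp(-α |z|²) dμ_{2n}(z)`
(conjugate linear in the first variable). -/
instance : InnerProductSpace.Core ℂ (PolyFock n m α hα) where
  inner f g := ∫ z, (starRingEnd ℂ) (f.toFun z) * g.toFun z ∂gaussMeasure n α
  conj_inner_symm f g := by
    rw [← integral_conj]
    simp [mul_comm]
  re_inner_nonneg f := by
    have e : ∀ z, (starRingEnd ℂ) (f.toFun z) * f.toFun z = ((‖f.toFun z‖ ^ 2 : ℝ) : ℂ) := by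
      intro z
      rw [mul_comm, Complex.mul_conj, Complex.normSq_eq_norm_sq]
    simp only [e]
    rw [integral_complex_ofReal]
    simpa using integral_nonneg (fun z => by positivity)
  add_left f g h := by
    have i : ∀ f : PolyFock n m α hα, Integrable
        (fun z => (starRingEnd ℂ) (f.toFun z) * h.toFun z) (gaussMeasure n α) := fun f =>
      f.memLp.star.integrable_mul h.memLp
    rw [← integral_add (i f) (i g)]
    refine integral_congr_ae (Filter.Eventually.of_forall fun z => ?_)
    change (starRingEnd ℂ) (f.toFun z + g.toFun z) * h.toFun z = _
    rw [map_add, add_mul]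
  smul_left f g c := by
    rw [← integral_const_mul]
    refine integral_congr_ae (Filter.Eventually.of_forall fun z => ?_)
    change (starRingEnd ℂ) (c * f.toFun z) * g.toFun z = _
    rw [map_mul, mul_assoc]
  definite f h := by
    have e : ∀ z, (starRingEnd ℂ) (f.toFun z) * f.toFun z = ((‖f.toFun z‖ ^ 2 : ℝ) : ℂ) := by
      intro z
      rw [mul_comm, Complex.mul_conj, Complex.normSq_eq_norm_sq]
    simp only [e] at h
    rw [integral_complex_ofReal] at h
    have h' : ∫ z, ‖f.toFun z‖ ^ 2 ∂gaussMeasure n α = 0 := by exact_mod_cast h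
    rw [integral_eq_zero_iff_of_nonneg (fun z => by positivity)
      (f.memLp.integrable_norm_pow (by norm_num))] at h'
    have h2 : f.toFun =ᵐ[volume] fun _ => 0 :=
      gaussMeasure_ae hα (h'.mono fun z hz => by simpa using hz)
    exact Subtype.ext ((Continuous.ae_eq_iff_eq volume f.continuous continuous_const).1 h2)

instance : NormedAddCommGroup (PolyFock n m α hα) :=
  InnerProductSpace.Core.toNormedAddCommGroup (𝕜 := ℂ)

instance : InnerProductSpace ℂ (PolyFock n m α hα) := InnerProductSpace.ofCore _

theorem integral_gaussMeasure (hα : 0 < α) (f : Cn n → ℂ) :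
    ∫ z, f z ∂gaussMeasure n α =
      (α ^ n / Real.pi ^ n : ℝ) * ∫ z, f z * (Real.exp (-α * ‖z‖ ^ 2) : ℝ) := by
  unfold gaussMeasure
  have hmeas : Measurable fun z : Cn n => ENNReal.ofReal (gaussWeight n α z) :=
    (ENNReal.continuous_ofReal.comp gaussWeight_continuous).measurable
  rw [integral_withDensity_eq_integral_toReal_smul hmeas
    (Filter.Eventually.of_forall fun z => by simp), ← integral_const_mul]
  refine integral_congr_ae (Filter.Eventually.of_forall fun z => ?_)
  simp only [ENNReal.toReal_ofReal (gaussWeight_pos hα z).le, Complex.real_smul]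
  simp only [gaussWeight, Complex.ofReal_mul]
  ring

/-- The inner product as an integral against Lebesgue measure. -/
theorem PolyFock.inner_eq (f g : PolyFock n m α hα) :
    inner ℂ f g = (α ^ n / Real.pi ^ n : ℝ) *
      ∫ z, (starRingEnd ℂ) (f.toFun z) * g.toFun z * (Real.exp (-α * ‖z‖ ^ 2) : ℝ) :=
  integral_gaussMeasure hα _

/-- The norm as an integral against Lebesgue measure. -/
theorem PolyFock.norm_eq (f : PolyFock n m α hα) :
    ‖f‖ = √(α ^ n / Real.pi ^ n * ∫ z, ‖f.toFun z‖ ^ 2 * Real.exp (-α * ‖z‖ ^ 2)) := by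
  have e : ∀ z, (starRingEnd ℂ) (f.toFun z) * f.toFun z * (Real.exp (-α * ‖z‖ ^ 2) : ℝ)
      = ((‖f.toFun z‖ ^ 2 * Real.exp (-α * ‖z‖ ^ 2) : ℝ) : ℂ) := by
    intro z
    rw [mul_comm ((starRingEnd ℂ) _), Complex.mul_conj, Complex.normSq_eq_norm_sq]
    push_cast
    ring
  rw [norm_eq_sqrt_re_inner (𝕜 := ℂ), PolyFock.inner_eq]
  simp only [e]
  rw [integral_complex_ofReal, ← Complex.ofReal_mul]
  rfl

end PolyFockSpace

end

noncomputable section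

namespace PolyFockSpace

open MeasureTheory Complex
open scoped ContDiff

/-! ### Calculus of the Wirtinger operators -/

/-! The core is a weighted mean value property at the origin (`integral_mAnalytic_mul_laguerre`).
The restriction of an `m`-analytic `f` to a complex line through `0` is a one-variable polyanalytic
function `∑ z̄ʲ gⱼ(z)` with `j < m` and `gⱼ` entire. On `|z| = r` one has `z̄ = r²/z`, so Cauchy's
formula shows that its circle averages are polynomials in `r²` of degree at most `m - 1` with
constant term `f 0` (`exists_circleAverage_eq`). Against the radial Gaussian weight in real
dimension `2n`, the polynomial `L_{m-1}^{(n)}(α r²)` annihilates `r², …, r^{2(m-1)}` and acts on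
constants as `1` does (`integral_pow_mul_laguerre`). Rotation invariance and polar coordinates then
leave only `f 0`.

Translating to `z` and multiplying by the holomorphic factor `exp(-α⟨w, z⟩)` turns this into the
reproducing formula for `exp(α⟨w, z⟩) L_{m-1}^{(n)}(α|w - z|²)`
(`IsMAnalytic.eq_integral_polyKernel`). This function is itself `m`-analytic and square integrable,
so point evaluations are inner products with it, hence bounded.

For completeness, take the `L²` limit `φ` of a Cauchy sequence and set `F z = ⟨K_z, φ⟩`.
Differentiation under the integral makes `F` an `m`-analytic function, and it is the pointwise limit
of the sequence, so `F = φ` almost everywhere (`completeSpace_polyFock`).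

The product forms and `d_{n,m}` come from generating functions: `∑ L_p^{(a)}(x) tᵖ = (1 - t)^{-a-1}
exp(-xt/(1 - t))` is multiplicative in the pair `(a + 1, x)`, which yields `sum_J_prod_laguerre`.
The norm is `K_z(z)^{1/2}`. -/

theorem wirtingerBar_comm {n : ℕ} (i j : Fin n) {f : Cn n → ℂ} (hf : ContDiff ℝ ∞ f) :
    wirtingerBar i (wirtingerBar j f) = wirtingerBar j (wirtingerBar i f) := by
  funext z
  have hd : DifferentiableAt ℝ (fderiv ℝ f) z :=
    ((hf.fderiv_right (m := ∞) (by simp)).differentiable (by simp)) z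
  have key : ∀ (j : Fin n) (v : Cn n), fderiv ℝ (wirtingerBar j f) z v =
      (1 / 2 : ℂ) * (fderiv ℝ (fderiv ℝ f) z v (EuclideanSpace.single j (1 : ℂ))
        + I * fderiv ℝ (fderiv ℝ f) z v (EuclideanSpace.single j I)) := by
    intro j v
    have h1 : ∀ u : Cn n, HasFDerivAt (fun x => fderiv ℝ f x u)
        ((fderiv ℝ (fderiv ℝ f) z).flip u) z := fun u => by
      simpa using hd.hasFDerivAt.clm_apply (hasFDerivAt_const u z)
    have h2 := ((h1 (EuclideanSpace.single j (1 : ℂ))).add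
      ((h1 (EuclideanSpace.single j I)).const_mul I)).const_mul (1 / 2 : ℂ)
    have h3 : wirtingerBar j f = fun x => (1 / 2 : ℂ) *
      (fderiv ℝ f x (EuclideanSpace.single j (1 : ℂ))
        + I * fderiv ℝ f x (EuclideanSpace.single j I)) := rfl
    rw [h3]
    erw [h2.fderiv]
    simp [mul_add]
  have hs : IsSymmSndFDerivAt ℝ f z :=
    (hf.contDiffAt).isSymmSndFDerivAt (by
      simpa [minSmoothness_of_isRCLikeNormedField] using
        WithTop.coe_le_coe.2 (le_top : (2 : ℕ∞) ≤ ⊤))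
  have e : ∀ a b : Cn n, fderiv ℝ (fderiv ℝ f) z a b = fderiv ℝ (fderiv ℝ f) z b a := hs
  rw [wirtingerBar, wirtingerBar, key, key, key, key,
    e (EuclideanSpace.single i (1 : ℂ)) (EuclideanSpace.single j (1 : ℂ)),
    e (EuclideanSpace.single i (1 : ℂ)) (EuclideanSpace.single j I),
    e (EuclideanSpace.single i I) (EuclideanSpace.single j (1 : ℂ)),
    e (EuclideanSpace.single i I) (EuclideanSpace.single j I)]
  ring

theorem wirtingerBar_iterate_contDiff {n : ℕ} (j : Fin n) (p : ℕ) {f : Cn n → ℂ}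
    (hf : ContDiff ℝ ∞ f) : ContDiff ℝ ∞ ((wirtingerBar j)^[p] f) :=
  (wirtingerBar_iterate j p 0 hf hf).1

theorem wirtingerBar_iterate_comm {n : ℕ} (i j : Fin n) (p : ℕ) {f : Cn n → ℂ}
    (hf : ContDiff ℝ ∞ f) :
    (wirtingerBar j)^[p] (wirtingerBar i f) = wirtingerBar i ((wirtingerBar j)^[p] f) := by
  induction p with
  | zero => rfl
  | succ p ih =>
    rw [Function.iterate_succ_apply', Function.iterate_succ_apply', ih,
      wirtingerBar_comm _ _ (wirtingerBar_iterate_contDiff j p hf)]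

theorem foldr_wirtingerBar_contDiff {n : ℕ} (k : Fin n → ℕ) (l : List (Fin n)) {f : Cn n → ℂ}
    (hf : ContDiff ℝ ∞ f) :
    ContDiff ℝ ∞ (l.foldr (fun j g => (wirtingerBar j)^[k j] g) f) := by
  induction l with
  | nil => exact hf
  | cons j l ih => exact wirtingerBar_iterate_contDiff j (k j) ih

theorem foldr_wirtingerBar {n : ℕ} (k : Fin n → ℕ) (i : Fin n) (l : List (Fin n))
    {f : Cn n → ℂ} (hf : ContDiff ℝ ∞ f) :
    l.foldr (fun j g => (wirtingerBar j)^[k j] g) (wirtingerBar i f) =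
      wirtingerBar i (l.foldr (fun j g => (wirtingerBar j)^[k j] g) f) := by
  induction l with
  | nil => rfl
  | cons j l ih =>
    rw [List.foldr_cons, ih, wirtingerBar_iterate_comm i j (k j)
      (foldr_wirtingerBar_contDiff k l hf), List.foldr_cons]

/-- Since the operators commute on smooth functions, an extra derivative applied first can be
carried to its slot in the ordered product. -/
theorem wirtingerBarPow_wirtingerBar {n : ℕ} (k : Fin n → ℕ) (i : Fin n) {f : Cn n → ℂ}
    (hf : ContDiff ℝ ∞ f) :
    wirtingerBarPow k (wirtingerBar i f) = wirtingerBarPow (k + Pi.single i 1) f := by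
  rw [wirtingerBarPow, foldr_wirtingerBar k i _ hf, wirtingerBarPow]
  -- For a general list the extra derivative appears only if `i` is listed; `Nodup` ensures that it
  -- appears just once.
  suffices h : ∀ l : List (Fin n), l.Nodup →
      l.foldr (fun j g => (wirtingerBar j)^[(k + Pi.single i 1 : Fin n → ℕ) j] g) f =
      if i ∈ l then wirtingerBar i (l.foldr (fun j g => (wirtingerBar j)^[k j] g) f)
        else l.foldr (fun j g => (wirtingerBar j)^[k j] g) f by
    rw [h _ (List.nodup_finRange n), if_pos (List.mem_finRange i)]
  intro l
  induction l with
  | nil => simp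
  | cons j l ih =>
    intro hl
    rw [List.nodup_cons] at hl
    rw [List.foldr_cons, ih hl.2, List.foldr_cons]
    by_cases hji : j = i
    · subst hji
      simp [hl.1, Function.iterate_succ_apply']
    · have hij : i ≠ j := fun h => hji h.symm
      by_cases hil : i ∈ l
      · simp [hil, hji, wirtingerBar_iterate_comm i j (k j) (foldr_wirtingerBar_contDiff k l hf)]
      · simp [hil, hji, hij]

theorem wirtingerBarPow_zero {n : ℕ} (f : Cn n → ℂ) : wirtingerBarPow 0 f = f := by
  unfold wirtingerBarPow
  induction List.finRange n with
  | nil => rfl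
  | cons j l ih => rw [List.foldr_cons, ih]; rfl

theorem isMAnalytic_zero_iff {n : ℕ} {f : Cn n → ℂ} : IsMAnalytic 0 f ↔ f = 0 := by
  constructor
  · intro h
    funext z
    have := h.2 0 (by simp) z
    rwa [wirtingerBarPow_zero] at this
  · rintro rfl
    exact IsMAnalytic.zero

/-- A multiindex of weight `p + 1` has a nonzero entry, and one derivative can be peeled off there.
This recursion replaces multiindices by induction on the order in the closure properties below. -/
theorem isMAnalytic_succ_iff {n p : ℕ} {f : Cn n → ℂ} :
    IsMAnalytic (p + 1) f ↔ ContDiff ℝ ∞ f ∧ ∀ j, IsMAnalytic p (wirtingerBar j f) := by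
  constructor
  · intro h
    refine ⟨h.1, fun j => ⟨wirtingerBar_contDiff j h.1, fun k hk z => ?_⟩⟩
    rw [wirtingerBarPow_wirtingerBar k j h.1]
    exact h.2 _ (by simp [Finset.sum_add_distrib, hk]) z
  · rintro ⟨hf, h⟩
    refine ⟨hf, fun k hk z => ?_⟩
    obtain ⟨j, hj⟩ : ∃ j, k j ≠ 0 := by
      by_contra! hc
      simp [hc] at hk
    have e : k = (k - Pi.single j 1) + Pi.single j 1 := by
      funext i
      by_cases hij : i = j
      · subst hij; simp; omega
      · simp [hij]
    have hs : ∑ r, (k - Pi.single j 1 : Fin n → ℕ) r = p := by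
      rw [e] at hk
      simp only [Pi.add_apply, Finset.sum_add_distrib] at hk
      simpa using hk
    rw [e, ← wirtingerBarPow_wirtingerBar _ j hf]
    exact (h j).2 _ hs z

theorem IsMAnalytic.add {n p : ℕ} {f g : Cn n → ℂ} (hf : IsMAnalytic p f)
    (hg : IsMAnalytic p g) : IsMAnalytic p (f + g) := by
  simpa using hf.lin hg 1

theorem IsMAnalytic.smul {n p : ℕ} {f : Cn n → ℂ} (hf : IsMAnalytic p f) (c : ℂ) :
    IsMAnalytic p (c • f) := by
  simpa using IsMAnalytic.zero.lin hf c

theorem IsMAnalytic.sum {n p : ℕ} {ι : Type*} (s : Finset ι) {f : ι → Cn n → ℂ}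
    (hf : ∀ i ∈ s, IsMAnalytic p (f i)) : IsMAnalytic p (∑ i ∈ s, f i) := by
  classical
  induction s using Finset.induction_on with
  | empty => simpa using IsMAnalytic.zero
  | insert i s hi ih =>
    rw [Finset.sum_insert hi]
    exact (hf i (by simp)).add (ih fun j hj => hf j (by simp [hj]))

theorem IsMAnalytic.succ {n p : ℕ} {f : Cn n → ℂ} (hf : IsMAnalytic p f) :
    IsMAnalytic (p + 1) f := by
  induction p generalizing f with
  | zero =>
    rw [isMAnalytic_zero_iff] at hf
    subst hf
    exact IsMAnalytic.zero
  | succ p ih =>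
    exact isMAnalytic_succ_iff.2 ⟨hf.1, fun j => ih ((isMAnalytic_succ_iff.1 hf).2 j)⟩

theorem IsMAnalytic.mono {n p q : ℕ} {f : Cn n → ℂ} (hf : IsMAnalytic p f) (h : p ≤ q) :
    IsMAnalytic q f := by
  induction h with
  | refl => exact hf
  | step _ ih => exact ih.succ

/-! ### Products, translations and the order of analyticity -/

theorem wirtingerBar_mul {n : ℕ} (j : Fin n) {f g : Cn n → ℂ} (hf : ContDiff ℝ ∞ f)
    (hg : ContDiff ℝ ∞ g) :
    wirtingerBar j (f * g) = f * wirtingerBar j g + wirtingerBar j f * g := by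
  funext z
  have e := fderiv_mul ((hf.differentiable (by simp)) z) ((hg.differentiable (by simp)) z)
  simp only [wirtingerBar, e, Pi.add_apply, Pi.mul_apply, add_apply, smul_apply, smul_eq_mul]
  ring

theorem wirtingerBar_eq_zero {n : ℕ} (j : Fin n) {f : Cn n → ℂ} {z : Cn n}
    (hf : DifferentiableAt ℂ f z) : wirtingerBar j f z = 0 := by
  have e : (EuclideanSpace.single j I : Cn n) = I • EuclideanSpace.single j (1 : ℂ) := by
    ext i
    by_cases h : i = j <;> simp [h]
  rw [wirtingerBar, hf.fderiv_restrictScalars ℝ, e]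
  simp only [ContinuousLinearMap.coe_restrictScalars', map_smul, smul_eq_mul]
  linear_combination (1 / 2 : ℂ) * fderiv ℂ f z (EuclideanSpace.single j (1 : ℂ)) * I_mul_I

theorem isMAnalytic_one {n : ℕ} {f : Cn n → ℂ} (hs : ContDiff ℝ ∞ f)
    (hf : Differentiable ℂ f) : IsMAnalytic 1 f :=
  isMAnalytic_succ_iff.2 ⟨hs, fun j => isMAnalytic_zero_iff.2 (funext fun z =>
    wirtingerBar_eq_zero j (hf z))⟩

theorem IsMAnalytic.holomorphic_mul {n p : ℕ} {h f : Cn n → ℂ} (hs : ContDiff ℝ ∞ h)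
    (hd : Differentiable ℂ h) (hf : IsMAnalytic p f) : IsMAnalytic p (h * f) := by
  induction p generalizing f with
  | zero =>
    rw [isMAnalytic_zero_iff] at hf ⊢
    rw [hf, mul_zero]
  | succ p ih =>
    obtain ⟨h1, h2⟩ := isMAnalytic_succ_iff.1 hf
    refine isMAnalytic_succ_iff.2 ⟨hs.mul h1, fun j => ?_⟩
    have : wirtingerBar j h = 0 := funext fun z => wirtingerBar_eq_zero j (hd z)
    rw [wirtingerBar_mul j hs h1, this, zero_mul, add_zero]
    exact ih (h2 j)

theorem contDiff_coord {n : ℕ} (r : Fin n) : ContDiff ℝ ∞ (fun z : Cn n => z r) :=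
  (EuclideanSpace.proj (𝕜 := ℂ) r).contDiff.restrict_scalars ℝ

theorem differentiable_coord {n : ℕ} (r : Fin n) : Differentiable ℂ (fun z : Cn n => z r) :=
  (EuclideanSpace.proj (𝕜 := ℂ) r).differentiable

theorem contDiff_conj_coord {n : ℕ} (r : Fin n) :
    ContDiff ℝ ∞ (fun z : Cn n => (starRingEnd ℂ) (z r)) :=
  conjCLE.contDiff.comp (contDiff_coord r)

theorem wirtingerBar_conj_coord {n : ℕ} (j r : Fin n) (z : Cn n) :
    wirtingerBar j (fun z : Cn n => (starRingEnd ℂ) (z r)) z = if j = r then 1 else 0 := by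
  have e : HasFDerivAt (fun z : Cn n => (starRingEnd ℂ) (z r))
      ((conjCLE : ℂ →L[ℝ] ℂ).comp
        ((EuclideanSpace.proj r : Cn n →L[ℂ] ℂ).restrictScalars ℝ)) z :=
    ((conjCLE : ℂ →L[ℝ] ℂ).comp
      ((EuclideanSpace.proj r : Cn n →L[ℂ] ℂ).restrictScalars ℝ)).hasFDerivAt
  rw [wirtingerBar, e.fderiv]
  by_cases h : j = r
  · subst h
    simp
    norm_num
  · have h' : r ≠ j := fun h' => h h'.symm
    simp [h, h']

/-- By the Leibniz rule each `∂̄_j` either falls on `f` and lowers its order, or turns `z̄_r` into a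
constant. Either way one order is lost, so an antiholomorphic coordinate costs only one order. -/
theorem IsMAnalytic.conj_coord_mul {n p : ℕ} (r : Fin n) {f : Cn n → ℂ}
    (hf : IsMAnalytic p f) :
    IsMAnalytic (p + 1) ((fun z : Cn n => (starRingEnd ℂ) (z r)) * f) := by
  induction p generalizing f with
  | zero =>
    rw [isMAnalytic_zero_iff] at hf
    subst hf
    rw [mul_zero]
    exact IsMAnalytic.zero
  | succ p ih =>
    obtain ⟨h1, h2⟩ := isMAnalytic_succ_iff.1 hf
    refine isMAnalytic_succ_iff.2 ⟨(contDiff_conj_coord r).mul h1, fun j => ?_⟩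
    rw [wirtingerBar_mul j (contDiff_conj_coord r) h1]
    refine (ih (h2 j)).add ?_
    have : wirtingerBar j (fun z : Cn n => (starRingEnd ℂ) (z r)) =
        fun _ => if j = r then 1 else 0 := funext fun z => wirtingerBar_conj_coord j r z
    rw [this]
    exact hf.smul (if j = r then 1 else 0)

theorem wirtingerBar_comp_add_right {n : ℕ} (j : Fin n) (f : Cn n → ℂ) (a : Cn n) :
    wirtingerBar j (fun z => f (z + a)) = fun z => wirtingerBar j f (z + a) := by
  funext z
  simp [wirtingerBar, fderiv_comp_add_right]

theorem IsMAnalytic.comp_add_right {n p : ℕ} {f : Cn n → ℂ} (hf : IsMAnalytic p f) (a : Cn n) :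
    IsMAnalytic p (fun z => f (z + a)) := by
  induction p generalizing f with
  | zero =>
    rw [isMAnalytic_zero_iff] at hf ⊢
    subst hf
    rfl
  | succ p ih =>
    obtain ⟨h1, h2⟩ := isMAnalytic_succ_iff.1 hf
    refine isMAnalytic_succ_iff.2 ⟨h1.comp (contDiff_id.add contDiff_const), fun j => ?_⟩
    rw [wirtingerBar_comp_add_right]
    exact ih (h2 j)

theorem sq_norm_sub_eq {n : ℕ} (w z : Cn n) :
    ((‖w - z‖ ^ 2 : ℝ) : ℂ) =
      ∑ r, (w r - z r) * ((starRingEnd ℂ) (w r) - (starRingEnd ℂ) (z r)) := by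
  rw [EuclideanSpace.norm_sq_eq, ofReal_sum]
  refine Finset.sum_congr rfl fun r _ => ?_
  rw [← map_sub, Complex.mul_conj, Complex.normSq_eq_norm_sq]
  rfl

/-- Each summand of `|w - z|²` is a holomorphic factor times one of degree one in `w̄_r`; only the
latter raises the order. -/
theorem IsMAnalytic.sq_norm_sub_mul {n p : ℕ} (z : Cn n) {f : Cn n → ℂ}
    (hf : IsMAnalytic p f) :
    IsMAnalytic (p + 1) (fun w => ((‖w - z‖ ^ 2 : ℝ) : ℂ) * f w) := by
  have e : (fun w => ((‖w - z‖ ^ 2 : ℝ) : ℂ) * f w) =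
      ∑ r, ((fun w : Cn n => w r - z r) * ((fun w : Cn n => (starRingEnd ℂ) (w r)) * f
        + (-(starRingEnd ℂ) (z r)) • f)) := by
    funext w
    rw [sq_norm_sub_eq, Finset.sum_mul, Finset.sum_apply]
    refine Finset.sum_congr rfl fun r _ => ?_
    simp
    ring
  rw [e]
  refine IsMAnalytic.sum _ fun r _ => IsMAnalytic.holomorphic_mul
    ((contDiff_coord r).sub contDiff_const) ((differentiable_coord r).sub_const _)
    ((hf.conj_coord_mul r).add (hf.succ.smul _))

/-! ### Restriction to complex lines -/

/-- The Wirtinger derivative `∂h/∂z̄` in one variable. -/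
def dbar (h : ℂ → ℂ) (t : ℂ) : ℂ := (1 / 2 : ℂ) * (fderiv ℝ h t 1 + I * fderiv ℝ h t I)

theorem dbar_contDiff {h : ℂ → ℂ} (hh : ContDiff ℝ ∞ h) : ContDiff ℝ ∞ (dbar h) := by
  have h1 : ContDiff ℝ ∞ (fderiv ℝ h) := hh.fderiv_right (by simp)
  unfold dbar
  exact contDiff_const.mul ((h1.clm_apply contDiff_const).add
    (contDiff_const.mul (h1.clm_apply contDiff_const)))

/-- Chain rule: `t ↦ t w` is holomorphic, so only the `∂̄_j f` contribute, with the constant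
coefficients `conj (w j)`. Iteration therefore stays within linear combinations of slices. -/
theorem dbar_slice {n : ℕ} {f : Cn n → ℂ} (hf : ContDiff ℝ ∞ f) (w : Cn n) :
    dbar (fun t : ℂ => f (t • w)) =
      fun t => (∑ j, (starRingEnd ℂ) (w j) • wirtingerBar j f) (t • w) := by
  funext t
  have h1 : HasFDerivAt (fun t : ℂ => t • w)
      (((ContinuousLinearMap.id ℂ ℂ).smulRight w).restrictScalars ℝ) t :=
    (((ContinuousLinearMap.id ℂ ℂ).smulRight w).restrictScalars ℝ).hasFDerivAt
  have h2 := ((hf.differentiable (by simp)) (t • w)).hasFDerivAt.comp t h1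
  have h3 : fderiv ℝ (fun t : ℂ => f (t • w)) t = _ := h2.fderiv
  -- The real derivative is only real linear, so `c • w` is expanded in the real basis `e_j`, `i
  -- e_j`.
  have hw : ∀ c : ℂ, fderiv ℝ f (t • w) (c • w) =
      ∑ j, (((c * w j).re : ℂ) * fderiv ℝ f (t • w) (EuclideanSpace.single j (1 : ℂ))
        + ((c * w j).im : ℂ) * fderiv ℝ f (t • w) (EuclideanSpace.single j I)) := by
    intro c
    have e : c • w = ∑ j, ((c * w j).re • EuclideanSpace.single j (1 : ℂ)
        + (c * w j).im • EuclideanSpace.single j I : Cn n) := by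
      ext i
      simp only [PiLp.smul_apply, smul_eq_mul, WithLp.ofLp_sum, Finset.sum_apply,
        WithLp.ofLp_add, Pi.add_apply, WithLp.ofLp_smul, Pi.smul_apply]
      rw [Finset.sum_eq_single i]
      · simpa [mul_comm] using (re_add_im (c * w i)).symm
      · intro j _ hj
        simp [hj.symm]
      · simp
    rw [e, map_sum]
    refine Finset.sum_congr rfl fun j _ => ?_
    rw [map_add, map_smul, map_smul]
    simp
  rw [dbar, h3]
  simp only [ContinuousLinearMap.comp_apply, ContinuousLinearMap.coe_restrictScalars',
    ContinuousLinearMap.smulRight_apply, ContinuousLinearMap.id_apply, hw, Finset.mul_sum,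
    ← Finset.sum_add_distrib, Finset.sum_apply, Pi.smul_apply, wirtingerBar, smul_eq_mul]
  refine Finset.sum_congr rfl fun j _ => ?_
  have hc : (starRingEnd ℂ) (w j) = (w j).re - (w j).im * I := by
    apply Complex.ext <;> simp
  rw [hc]
  simp
  ring_nf
  simp only [I_sq]
  ring

theorem IsMAnalytic.slice {n p : ℕ} {f : Cn n → ℂ} (hf : IsMAnalytic p f) (w : Cn n) :
    dbar^[p] (fun t : ℂ => f (t • w)) = 0 := by
  induction p generalizing f with
  | zero =>
    rw [isMAnalytic_zero_iff] at hf
    subst hf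
    rfl
  | succ p ih =>
    obtain ⟨h1, h2⟩ := isMAnalytic_succ_iff.1 hf
    rw [Function.iterate_succ_apply, dbar_slice h1]
    exact ih (IsMAnalytic.sum _ fun j _ => (h2 j).smul _)

theorem slice_contDiff {n : ℕ} {f : Cn n → ℂ} (hf : ContDiff ℝ ∞ f) (w : Cn n) :
    ContDiff ℝ ∞ (fun t : ℂ => f (t • w)) :=
  hf.comp (((ContinuousLinearMap.id ℂ ℂ).smulRight w).restrictScalars ℝ).contDiff

/-! ### Polyanalytic functions of one variable -/

theorem dbar_add {f g : ℂ → ℂ} (hf : ContDiff ℝ ∞ f) (hg : ContDiff ℝ ∞ g) :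
    dbar (f + g) = dbar f + dbar g := by
  funext z
  have e := fderiv_add ((hf.differentiable (by simp)) z) ((hg.differentiable (by simp)) z)
  simp only [dbar, e, Pi.add_apply, add_apply]
  ring

/-- The equation `∂h/∂z̄ = 0` is the Cauchy–Riemann system. -/
theorem differentiable_of_dbar_eq_zero {h : ℂ → ℂ} (hh : ContDiff ℝ ∞ h) (h0 : dbar h = 0) :
    Differentiable ℂ h := by
  intro z
  rw [differentiableAt_complex_iff_differentiableAt_real]
  refine ⟨(hh.differentiable (by simp)) z, ?_⟩
  have e : (1 / 2 : ℂ) * (fderiv ℝ h z 1 + I * fderiv ℝ h z I) = 0 := congrFun h0 z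
  rw [smul_eq_mul]
  linear_combination (-2 * I) * e + fderiv ℝ h z I * I_mul_I

theorem dbar_conj_pow_mul (j : ℕ) {g : ℂ → ℂ} (hg : Differentiable ℂ g) (z : ℂ) :
    dbar (fun z => (starRingEnd ℂ) z ^ (j + 1) * g z) z =
      (j + 1) * ((starRingEnd ℂ) z ^ j * g z) := by
  have h1 : HasFDerivAt (fun z : ℂ => (starRingEnd ℂ) z) (conjCLE : ℂ →L[ℝ] ℂ) z :=
    (conjCLE : ℂ →L[ℝ] ℂ).hasFDerivAt
  have h2 := (h1.pow (j + 1)).mul ((hg z).hasFDerivAt.restrictScalars ℝ)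
  have e : fderiv ℝ (fun z => (starRingEnd ℂ) z ^ (j + 1) * g z) z = _ := h2.fderiv
  have e2 : fderiv ℂ g z I = I * fderiv ℂ g z 1 := by
    rw [← smul_eq_mul, ← map_smul, smul_eq_mul, mul_one]
  rw [dbar, e]
  simp [e2]
  ring_nf
  simp only [I_sq]
  ring

theorem conj_pow_mul_contDiff (j : ℕ) {g : ℂ → ℂ} (hg : Differentiable ℂ g) :
    ContDiff ℝ ∞ (fun z => (starRingEnd ℂ) z ^ j * g z) :=
  (conjCLE.contDiff.pow j).mul ((hg.contDiff (n := ∞)).restrict_scalars ℝ)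

/-- The decomposition `h = ∑ z̄ʲ gⱼ` of a polyanalytic function with `gⱼ` entire. -/
theorem exists_polyanalytic_decomposition (m : ℕ) {h : ℂ → ℂ} (hh : ContDiff ℝ ∞ h)
    (h0 : dbar^[m] h = 0) : ∃ g : ℕ → ℂ → ℂ, (∀ j, Differentiable ℂ (g j)) ∧
      h = fun z => ∑ j ∈ Finset.range m, (starRingEnd ℂ) z ^ j * g j z := by
  induction m generalizing h with
  | zero =>
    refine ⟨fun _ => 0, fun _ => differentiable_const _, ?_⟩
    funext z
    simpa using congrFun h0 z
  | succ m ih =>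
    obtain ⟨g, hg, e⟩ := ih (dbar_contDiff hh) h0
    -- The factor is chosen so that `∂̄(z̄^{j+1} G_j) = -z̄ʲ g_j`; adding these terms to `h` cancels
    -- `∂̄h`.
    set G : ℕ → ℂ → ℂ := fun j z => (-1 / (j + 1) : ℂ) * g j z with hG
    have hGd : ∀ j, Differentiable ℂ (G j) := fun j => (hg j).const_mul _
    have key : ∀ k : ℕ, ContDiff ℝ ∞
        (h + fun z => ∑ j ∈ Finset.range k, (starRingEnd ℂ) z ^ (j + 1) * G j z) ∧
        dbar (h + fun z => ∑ j ∈ Finset.range k, (starRingEnd ℂ) z ^ (j + 1) * G j z) =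
          dbar h - fun z => ∑ j ∈ Finset.range k, (starRingEnd ℂ) z ^ j * g j z := by
      intro k
      induction k with
      | zero =>
        have e1 : (h + fun z => ∑ j ∈ Finset.range 0, (starRingEnd ℂ) z ^ (j + 1) * G j z) = h := by
          funext z; simp
        rw [e1]
        refine ⟨hh, ?_⟩
        funext z
        simp
      | succ k ihk =>
        have e1 : (h + fun z => ∑ j ∈ Finset.range (k + 1), (starRingEnd ℂ) z ^ (j + 1) * G j z)
            = (h + fun z => ∑ j ∈ Finset.range k, (starRingEnd ℂ) z ^ (j + 1) * G j z)
              + fun z => (starRingEnd ℂ) z ^ (k + 1) * G k z := by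
          funext z; simp [Finset.sum_range_succ, add_assoc]
        rw [e1]
        refine ⟨ihk.1.add (conj_pow_mul_contDiff _ (hGd k)), ?_⟩
        rw [dbar_add ihk.1 (conj_pow_mul_contDiff _ (hGd k)), ihk.2]
        funext z
        have hk : (k + 1 : ℂ) ≠ 0 := Nat.cast_add_one_ne_zero k
        simp only [Pi.add_apply, Pi.sub_apply, dbar_conj_pow_mul k (hGd k),
          Finset.sum_range_succ]
        simp only [hG]
        field_simp
        ring
    obtain ⟨k1, k2⟩ := key m
    -- The corrected function is entire and becomes the coefficient of `z̄⁰`; the functions `-G j`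
    -- move up to index `j + 1`.
    have hd := differentiable_of_dbar_eq_zero k1 (by rw [k2, e, sub_self])
    refine ⟨fun j => Nat.casesOn j
      (h + fun z => ∑ j ∈ Finset.range m, (starRingEnd ℂ) z ^ (j + 1) * G j z)
      (fun j => -G j), fun j => ?_, ?_⟩
    · cases j with
      | zero => exact hd
      | succ j => exact (hGd j).neg
    · funext z
      simp [Finset.sum_range_succ']

/-- On the circle `z̄ = r²/z`, so the average is `r^{2j}` times Cauchy's integral for the `j`-th
Taylor coefficient of `g`. -/
theorem circleAverage_conj_pow_mul (j : ℕ) {g : ℂ → ℂ} (hg : Differentiable ℂ g) {r : ℝ}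
    (hr : 0 < r) : Real.circleAverage (fun z => (starRingEnd ℂ) z ^ j * g z) 0 r =
      (iteratedDeriv j g 0 / j.factorial) * (r : ℂ) ^ (2 * j) := by
  have h := hg.diffContOnCl.circleIntegral_one_div_sub_center_pow_smul (c := 0) hr j
  rw [circleIntegral] at h
  have e : ∀ θ : ℝ, deriv (circleMap 0 r) θ • (1 / (circleMap 0 r θ - 0) ^ (j + 1)) •
      g (circleMap 0 r θ) =
      (I / (r : ℂ) ^ (2 * j)) * ((starRingEnd ℂ) (circleMap 0 r θ) ^ j * g (circleMap 0 r θ)) := by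
    intro θ
    have hz : circleMap 0 r θ ≠ 0 := circleMap_ne_center hr.ne'
    have hc : (starRingEnd ℂ) (circleMap 0 r θ) * circleMap 0 r θ = (r : ℂ) ^ 2 := by
      rw [mul_comm, Complex.mul_conj, Complex.normSq_eq_norm_sq]
      simp
    have hr' : (r : ℂ) ≠ 0 := by exact_mod_cast hr.ne'
    rw [deriv_circleMap, sub_zero, smul_eq_mul, smul_eq_mul, pow_mul, ← hc, mul_pow]
    have hzc : (starRingEnd ℂ) (circleMap 0 r θ) ≠ 0 := by simpa using hz
    field_simp
    ring
  simp_rw [e] at h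
  rw [intervalIntegral.integral_const_mul] at h
  rw [Real.circleAverage_def, Complex.real_smul]
  have hr' : (r : ℂ) ^ (2 * j) ≠ 0 := pow_ne_zero _ (by exact_mod_cast hr.ne')
  have hpi : (Real.pi : ℂ) ≠ 0 := by exact_mod_cast Real.pi_ne_zero
  rw [div_mul_eq_mul_div, div_eq_iff hr', smul_eq_mul] at h
  have h' := mul_left_cancel₀ I_ne_zero (h.trans (show _ = I * ((2 * Real.pi / j.factorial) *
    iteratedDeriv j g 0 * (r : ℂ) ^ (2 * j)) by ring))
  rw [h']
  push_cast
  field_simp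

/-- The circle averages of a polyanalytic function are polynomials in `r²`. -/
theorem exists_circleAverage_eq (m : ℕ) {h : ℂ → ℂ} (hh : ContDiff ℝ ∞ h)
    (h0 : dbar^[m + 1] h = 0) : ∃ c : ℕ → ℂ, c 0 = h 0 ∧ ∀ r : ℝ, 0 < r →
      Real.circleAverage h 0 r = ∑ j ∈ Finset.range (m + 1), c j * (r : ℂ) ^ (2 * j) := by
  obtain ⟨g, hg, e⟩ := exists_polyanalytic_decomposition (m + 1) hh h0
  refine ⟨fun j => iteratedDeriv j (g j) 0 / j.factorial, ?_, fun r hr => ?_⟩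
  · simp [e, Finset.sum_range_succ']
  · rw [e]
    have := Real.circleAverage_fun_sum (s := Finset.range (m + 1)) (c := 0) (R := r)
      (f := fun j z => (starRingEnd ℂ) z ^ j * g j z) (fun j _ =>
        ((conj_pow_mul_contDiff j (hg j)).continuous.continuousOn).circleIntegrable')
    rw [this]
    exact Finset.sum_congr rfl fun j _ => circleAverage_conj_pow_mul j (hg j) hr

/-! ### Identities for Laguerre polynomials -/

theorem coeff_mk_one_pow (d p : ℕ) :
    PowerSeries.coeff p ((PowerSeries.mk 1 : PowerSeries ℝ) ^ (d + 1)) = (d + p).choose d := by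
  rw [PowerSeries.mk_one_pow_eq_mk_choose_add, PowerSeries.coeff_mk]

/-- `PowerSeries.mk 1` is `1/(1 - X)`, so the binomial in the Laguerre polynomial is a coefficient
of `Xⁱ/(1 - X)^{a+i+1}`. -/
theorem coeff_X_pow_mul_mk_one_pow (a i p : ℕ) :
    PowerSeries.coeff p ((PowerSeries.X : PowerSeries ℝ) ^ i * PowerSeries.mk 1 ^ (a + i + 1)) =
      if i ≤ p then ((p + a).choose (p - i) : ℝ) else 0 := by
  rw [PowerSeries.coeff_X_pow_mul']
  split_ifs with h
  · rw [coeff_mk_one_pow]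
    have e : a + i + (p - i) = p + a := by omega
    rw [e, ← Nat.choose_symm (by omega : a + i ≤ p + a)]
    congr 2
    omega
  · rfl

/-- Terms with `i > p` vanish. The free upper limit `M` gives all factors of a convolution the same
summation range. -/
theorem laguerre_eq_sum (a p M : ℕ) (h : p ≤ M) (x : ℝ) :
    laguerre a p x = ∑ i ∈ Finset.range (M + 1), ((-x) ^ i / i.factorial) *
      PowerSeries.coeff p
        ((PowerSeries.X : PowerSeries ℝ) ^ i * PowerSeries.mk 1 ^ (a + i + 1)) := by
  rw [laguerre, ← Finset.sum_subset (Finset.range_mono (by omega : p + 1 ≤ M + 1))]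
  · refine Finset.sum_congr rfl fun i hi => ?_
    rw [coeff_X_pow_mul_mk_one_pow, if_pos (by simpa [Nat.lt_succ_iff] using hi), neg_pow]
    ring
  · intro i _ hi
    rw [coeff_X_pow_mul_mk_one_pow, if_neg (by simpa [Nat.lt_succ_iff] using hi), mul_zero]

theorem add_pow_div_factorial (x y : ℝ) (s : ℕ) :
    (x + y) ^ s / s.factorial =
      ∑ q ∈ Finset.HasAntidiagonal.antidiagonal s, (x ^ q.1 / q.1.factorial) * (y ^ q.2 / q.2.factorial) := by
  rw [(Commute.all x y).add_pow', Finset.sum_div]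
  refine Finset.sum_congr rfl fun q hq => ?_
  have h := Finset.HasAntidiagonal.mem_antidiagonal.1 hq
  have h2 : ((q.1 + q.2).choose q.1 * q.1.factorial * q.2.factorial : ℝ) = (q.1 + q.2).factorial := by
    rw [Nat.choose_symm_add]
    exact_mod_cast Nat.add_choose_mul_factorial_mul_factorial q.1 q.2
  have h3 : (q.1.factorial : ℝ) ≠ 0 := by exact_mod_cast q.1.factorial_ne_zero
  have h4 : (q.2.factorial : ℝ) ≠ 0 := by exact_mod_cast q.2.factorial_ne_zero
  have h5 : (s.factorial : ℝ) ≠ 0 := by exact_mod_cast s.factorial_ne_zero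
  rw [h] at h2
  rw [nsmul_eq_mul]
  field_simp
  rw [← h2]
  ring

theorem sum_range_mul_range_eq (N : ℕ) (F : ℕ → ℕ → ℝ) (hF : ∀ i j, N < i + j → F i j = 0) :
    ∑ i ∈ Finset.range (N + 1), ∑ j ∈ Finset.range (N + 1), F i j =
      ∑ s ∈ Finset.range (N + 1), ∑ q ∈ Finset.HasAntidiagonal.antidiagonal s, F q.1 q.2 := by
  rw [← Finset.sum_product', ← Finset.sum_filter_of_ne (p := fun q => q.1 + q.2 ∈ Finset.range (N + 1))
    (fun q _ hq => by
      by_contra hc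
      exact hq (hF _ _ (by simpa using hc)))]
  rw [← Finset.sum_fiberwise_of_maps_to (g := fun q : ℕ × ℕ => q.1 + q.2)
    (t := Finset.range (N + 1)) (fun q hq => (Finset.mem_filter.1 hq).2)]
  refine Finset.sum_congr rfl fun s hs => Finset.sum_congr ?_ fun _ _ => rfl
  ext q
  simp only [Finset.mem_filter, Finset.mem_product, Finset.mem_range, Finset.HasAntidiagonal.mem_antidiagonal]
    at hs ⊢
  omega

/-- This is the `N`-th coefficient of a product of generating functions. Powers of `1/(1 - X)` add,
`(a + 1) + (b + 1) = (a + b + 1) + 1`, and the binomial theorem merges the powers of `x` and `y`. -/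
theorem laguerre_add (a b N : ℕ) (x y : ℝ) :
    ∑ q ∈ Finset.HasAntidiagonal.antidiagonal N, laguerre a q.1 x * laguerre b q.2 y =
      laguerre (a + b + 1) N (x + y) := by
  have h1 : ∀ q ∈ Finset.HasAntidiagonal.antidiagonal N, laguerre a q.1 x * laguerre b q.2 y =
      ∑ i ∈ Finset.range (N + 1), ∑ j ∈ Finset.range (N + 1),
        ((-x) ^ i / i.factorial) * ((-y) ^ j / j.factorial) *
        (PowerSeries.coeff q.1
          ((PowerSeries.X : PowerSeries ℝ) ^ i * PowerSeries.mk 1 ^ (a + i + 1)) *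
        PowerSeries.coeff q.2
          ((PowerSeries.X : PowerSeries ℝ) ^ j * PowerSeries.mk 1 ^ (b + j + 1))) := by
    intro q hq
    have h := Finset.HasAntidiagonal.mem_antidiagonal.1 hq
    rw [laguerre_eq_sum a q.1 N (by omega), laguerre_eq_sum b q.2 N (by omega),
      Finset.sum_mul_sum]
    exact Finset.sum_congr rfl fun i _ => Finset.sum_congr rfl fun j _ => by ring
  rw [Finset.sum_congr rfl h1, Finset.sum_comm]
  have h2 : ∀ i ∈ Finset.range (N + 1), (∑ q ∈ Finset.HasAntidiagonal.antidiagonal N,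
      ∑ j ∈ Finset.range (N + 1),
        ((-x) ^ i / i.factorial) * ((-y) ^ j / j.factorial) *
        (PowerSeries.coeff q.1
          ((PowerSeries.X : PowerSeries ℝ) ^ i * PowerSeries.mk 1 ^ (a + i + 1)) *
        PowerSeries.coeff q.2
          ((PowerSeries.X : PowerSeries ℝ) ^ j * PowerSeries.mk 1 ^ (b + j + 1)))) =
      ∑ j ∈ Finset.range (N + 1), ((-x) ^ i / i.factorial) * ((-y) ^ j / j.factorial) *
        PowerSeries.coeff N ((PowerSeries.X : PowerSeries ℝ) ^ (i + j) *
          PowerSeries.mk 1 ^ ((a + b + 1) + (i + j) + 1)) := by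
    intro i _
    rw [Finset.sum_comm]
    refine Finset.sum_congr rfl fun j _ => ?_
    rw [← Finset.mul_sum, ← PowerSeries.coeff_mul]
    congr 2
    ring
  rw [Finset.sum_congr rfl h2, sum_range_mul_range_eq N, laguerre_eq_sum _ N N le_rfl]
  · refine Finset.sum_congr rfl fun s _ => ?_
    rw [neg_add, add_pow_div_factorial, Finset.sum_mul]
    refine Finset.sum_congr rfl fun q hq => ?_
    rw [Finset.HasAntidiagonal.mem_antidiagonal.1 hq]
  · intro i j hij
    rw [coeff_X_pow_mul_mk_one_pow, if_neg (by omega), mul_zero]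

theorem laguerre_zero (a p : ℕ) : laguerre a p 0 = (p + a).choose p := by
  rw [laguerre, Finset.sum_eq_single 0]
  · simp
  · intro i _ hi
    simp [hi]
  · simp

/-- The ordinary generating series of the Laguerre polynomials. -/
def laguerreSeries (a : ℕ) (x : ℝ) : PowerSeries ℝ := PowerSeries.mk fun p => laguerre a p x

theorem laguerreSeries_mul (a b : ℕ) (x y : ℝ) :
    laguerreSeries a x * laguerreSeries b y = laguerreSeries (a + b + 1) (x + y) := by
  ext N
  rw [PowerSeries.coeff_mul]
  simp only [laguerreSeries, PowerSeries.coeff_mk]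
  exact laguerre_add a b N x y

/-- The extra factor `laguerreSeries 0 0` is `1/(1 - X)`: it raises the parameter from `n - 1` to
`n` and turns coefficients into partial sums, hence the condition `|k| ≤ m - 1` instead of `|k| = m
- 1`. -/
theorem laguerreSeries_prod (n : ℕ) (x : Fin n → ℝ) :
    (∏ r, laguerreSeries 0 (x r)) * laguerreSeries 0 0 = laguerreSeries n (∑ r, x r) := by
  induction n with
  | zero => simp
  | succ n ih =>
    rw [Fin.prod_univ_succ, Fin.sum_univ_succ, mul_assoc, ih (fun r => x r.succ),
      laguerreSeries_mul]
    congr 1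
    ring

theorem sum_J_prod_laguerre (n p : ℕ) (x : Fin n → ℝ) :
    ∑ k ∈ J n (p + 1), ∏ r, laguerre 0 (k r) (x r) = laguerre n p (∑ r, x r) := by
  have h : PowerSeries.coeff p (laguerreSeries n (∑ r, x r)) = laguerre n p (∑ r, x r) := by
    simp [laguerreSeries]
  rw [← h, ← laguerreSeries_prod, mul_comm, PowerSeries.coeff_mul]
  have h1 : ∀ q : ℕ × ℕ, PowerSeries.coeff q.1 (laguerreSeries 0 0) = 1 := fun q => by
    simp [laguerreSeries, laguerre_zero]
  simp only [h1, one_mul, PowerSeries.coeff_prod]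
  rw [← Finset.Nat.sum_antidiagonal_swap]
  simp only [Prod.snd_swap]
  rw [Finset.Nat.sum_antidiagonal_eq_sum_range_succ_mk]
  rw [← Finset.sum_fiberwise_of_maps_to (s := J n (p + 1)) (g := fun k => ∑ r, k r)
    (t := Finset.range (p + 1)) (fun k hk => by
      have := (mem_J (by omega) k).1 hk
      simp only [Finset.mem_range]
      omega)]
  refine Finset.sum_congr rfl fun s hs => ?_
  refine Finset.sum_bij' (fun k _ => Finsupp.equivFunOnFinite.symm k) (fun l _ => l) ?_ ?_ ?_ ?_ ?_
  · intro k hk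
    simp only [Finset.mem_filter] at hk
    simp [Finset.mem_finsuppAntidiag, hk.2]
  · intro l hl
    simp only [Finset.mem_finsuppAntidiag] at hl
    simp only [Finset.mem_range] at hs
    simp only [Finset.mem_filter]
    exact ⟨(mem_J (by omega) _).2 (by rw [hl.1]; omega), hl.1⟩
  · intro k _
    rfl
  · intro l _
    ext r
    rfl
  · intro k _
    simp [laguerreSeries]

/-- At the origin every `L_k` equals `1`, so the summation formula there counts multiindices. -/
theorem card_J (n p : ℕ) : (J n (p + 1)).card = (p + n).choose p := by
  have h := sum_J_prod_laguerre n p (fun _ => 0)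
  simp only [laguerre_zero, Finset.sum_const_zero, add_zero, Nat.choose_self, Nat.cast_one,
    Finset.prod_const_one, Finset.sum_const, nsmul_eq_mul, mul_one] at h
  exact_mod_cast h

/-- Compare coefficients in `(1 + X)^{-d-1} (1 + X)^{N+d+1} = (1 + X)^N`. -/
theorem sum_neg_one_pow_choose (d N p : ℕ) :
    ∑ i ∈ Finset.range (p + 1), (-1 : ℝ) ^ i * ((d + i).choose d : ℝ) *
      ((N + d + 1).choose (p - i) : ℝ) = (N.choose p : ℝ) := by
  have h1 : (PowerSeries.rescale (-1 : ℝ)) (PowerSeries.mk 1 ^ (d + 1)) *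
      (1 + PowerSeries.X) ^ (N + d + 1) = (1 + PowerSeries.X : PowerSeries ℝ) ^ N := by
    have h2 : (PowerSeries.rescale (-1 : ℝ)) (PowerSeries.mk 1) * (1 + PowerSeries.X) = 1 := by
      have h3 := congrArg (PowerSeries.rescale (-1 : ℝ))
        (PowerSeries.mk_one_mul_one_sub_eq_one ℝ)
      simpa [PowerSeries.rescale_X] using h3
    rw [map_pow, add_assoc, pow_add _ N, mul_left_comm, ← mul_pow, h2, one_pow, mul_one]
  have hc : ∀ M q : ℕ, PowerSeries.coeff q ((1 + PowerSeries.X : PowerSeries ℝ) ^ M) =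
      M.choose q := by
    intro M q
    have : ((1 + PowerSeries.X : PowerSeries ℝ) ^ M) =
        (((1 + Polynomial.X : Polynomial ℝ) ^ M : Polynomial ℝ) : PowerSeries ℝ) := by simp
    rw [this, Polynomial.coeff_coe, Polynomial.coeff_one_add_X_pow]
  have h4 := congrArg (PowerSeries.coeff p) h1
  rw [hc, PowerSeries.coeff_mul, Finset.Nat.sum_antidiagonal_eq_sum_range_succ_mk] at h4
  rw [← h4]
  refine Finset.sum_congr rfl fun i _ => ?_
  rw [PowerSeries.coeff_rescale, coeff_mk_one_pow, hc]

/-! ### Radial Gaussian moments and Laguerre orthogonality -/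

theorem integrableOn_pow_mul_exp {α : ℝ} (hα : 0 < α) (l : ℕ) :
    IntegrableOn (fun r : ℝ => r ^ l * Real.exp (-α * r ^ 2)) (Set.Ioi 0) := by
  have h := (integrable_rpow_mul_exp_neg_mul_sq hα (s := l) (by
    have : (0 : ℝ) ≤ l := l.cast_nonneg
    linarith)).integrableOn (s := Set.Ioi 0)
  simpa using h

theorem integral_pow_mul_exp {α : ℝ} (hα : 0 < α) (l : ℕ) :
    ∫ r in Set.Ioi (0 : ℝ), r ^ (2 * l + 1) * Real.exp (-α * r ^ 2) =
      l.factorial / (2 * α ^ (l + 1)) := by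
  have h := _root_.integral_rpow_mul_exp_neg_mul_rpow (p := 2) (q := 2 * l + 1) (b := α)
    (by norm_num) (by have : (0 : ℝ) ≤ l := l.cast_nonneg
                      linarith) hα
  have e : ((2 * l + 1 + 1) / 2 : ℝ) = (l : ℝ) + 1 := by ring
  rw [neg_div, e, Real.Gamma_nat_eq_factorial, Real.rpow_neg hα.le] at h
  have e2 : α ^ ((l : ℝ) + 1) = α ^ (l + 1) := by exact_mod_cast Real.rpow_natCast α (l + 1)
  rw [e2] at h
  have e3 : ∀ r : ℝ, r ^ (2 * (l : ℝ) + 1) = r ^ (2 * l + 1) := fun r => by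
    exact_mod_cast Real.rpow_natCast r (2 * l + 1)
  have e4 : ∀ r : ℝ, r ^ (2 : ℝ) = r ^ 2 := fun r => by exact_mod_cast Real.rpow_natCast r 2
  simp only [e3, e4] at h
  rw [h]
  field_simp

theorem pow_mul_laguerre_mul_exp_eq (α : ℝ) (ν p j : ℕ) (r : ℝ) :
    r ^ (2 * ν + 1) *
      (r ^ (2 * j) * (laguerre (ν + 1) p (α * r ^ 2) * Real.exp (-α * r ^ 2))) =
      ∑ i ∈ Finset.range (p + 1), ((-1 : ℝ) ^ i * ((p + (ν + 1)).choose (p - i) : ℝ) * α ^ i /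
        (i.factorial : ℝ)) * (r ^ (2 * (ν + j + i) + 1) * Real.exp (-α * r ^ 2)) := by
  rw [laguerre, Finset.sum_mul, Finset.mul_sum, Finset.mul_sum]
  refine Finset.sum_congr rfl fun i _ => ?_
  rw [mul_pow, ← pow_mul]
  ring

theorem integrableOn_pow_mul_laguerre {α : ℝ} (hα : 0 < α) (ν p j : ℕ) :
    IntegrableOn (fun r : ℝ => r ^ (2 * ν + 1) *
      (r ^ (2 * j) * (laguerre (ν + 1) p (α * r ^ 2) * Real.exp (-α * r ^ 2)))) (Set.Ioi 0) := by
  simp only [pow_mul_laguerre_mul_exp_eq]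
  exact integrable_finsetSum _ fun i _ => (integrableOn_pow_mul_exp hα _).const_mul _

/-- Orthogonality of `L_p^{(ν+1)}` to the monomials in `r²` of degree between `1` and `p`. -/
theorem integral_pow_mul_laguerre {α : ℝ} (hα : 0 < α) (ν p j : ℕ) (hj : j ≤ p) :
    ∫ r in Set.Ioi (0 : ℝ), r ^ (2 * ν + 1) *
      (r ^ (2 * j) * (laguerre (ν + 1) p (α * r ^ 2) * Real.exp (-α * r ^ 2))) =
      if j = 0 then ∫ r in Set.Ioi (0 : ℝ), r ^ (2 * ν + 1) * Real.exp (-α * r ^ 2) else 0 := by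
  simp only [pow_mul_laguerre_mul_exp_eq]
  rw [integral_finsetSum _ fun i _ => (integrableOn_pow_mul_exp hα _).const_mul _]
  simp only [integral_const_mul, integral_pow_mul_exp hα]
  -- After the Gamma integrals the sum collapses to `(p - j).choose p`, which vanishes unless `j =
  -- 0`.
  have h := sum_neg_one_pow_choose (ν + j) (p - j) p
  have e2 : ∀ i ∈ Finset.range (p + 1), ((-1 : ℝ) ^ i * ((p + (ν + 1)).choose (p - i) : ℝ) * α ^ i /
        (i.factorial : ℝ)) * ((ν + j + i).factorial / (2 * α ^ (ν + j + i + 1))) =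
      ((ν + j).factorial / (2 * α ^ (ν + j + 1))) * ((-1 : ℝ) ^ i * ((ν + j + i).choose (ν + j) : ℝ) *
      ((p - j + (ν + j) + 1).choose (p - i) : ℝ)) := by
    intro i _
    have e3 : p - j + (ν + j) + 1 = p + (ν + 1) := by omega
    have e4 : ((ν + j + i).choose (ν + j) * (ν + j).factorial * i.factorial : ℝ) =
        (ν + j + i).factorial := by
      rw [Nat.choose_symm_add]
      exact_mod_cast Nat.add_choose_mul_factorial_mul_factorial (ν + j) i
    rw [e3, ← e4]
    have h3 : (i.factorial : ℝ) ≠ 0 := by exact_mod_cast i.factorial_ne_zero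
    field_simp
    ring
  rw [Finset.sum_congr rfl e2, ← Finset.mul_sum, h]
  split_ifs with hj0
  · subst hj0
    simp
  · rw [Nat.choose_eq_zero_of_lt (by omega)]
    simp

/-! ### Polar coordinates and circular means -/

section Polar

variable {E : Type*} [NormedAddCommGroup E] [NormedSpace ℝ E] [MeasurableSpace E]
  [FiniteDimensional ℝ E] [BorelSpace E] (μ : Measure E) [μ.IsAddHaarMeasure]

theorem integral_volumeIoiPow (k : ℕ) (g : ℝ → ℂ) :
    ∫ r : Set.Ioi (0 : ℝ), g r ∂Measure.volumeIoiPow k =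
      ∫ r in Set.Ioi (0 : ℝ), (r ^ k : ℝ) * g r := by
  simp only [Measure.volumeIoiPow, ENNReal.ofReal]
  rw [integral_withDensity_eq_integral_smul,
    ← integral_subtype_comap measurableSet_Ioi (fun r : ℝ => ((r ^ k : ℝ) : ℂ) * g r)]
  · refine integral_congr_ae (Filter.Eventually.of_forall ?_)
    rintro ⟨r, hr : 0 < r⟩
    have : 0 ≤ r ^ k := by positivity
    simp [NNReal.smul_def, Real.coe_toNNReal _ this]
  · fun_prop

/-- Remove the null set `{0}`, transport along the polar homeomorphism, and apply Fubini. -/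
theorem integral_eq_integral_sphere [Nontrivial E] {G : E → ℂ} (hG : Integrable G μ) :
    ∫ x, G x ∂μ = ∫ s, (∫ r in Set.Ioi (0 : ℝ),
      ((r ^ (Module.finrank ℝ E - 1) : ℝ) : ℂ) * G (r • (s : E))) ∂μ.toSphere := by
  have hmp := μ.measurePreserving_homeomorphUnitSphereProd
  have hme : MeasurableEmbedding (homeomorphUnitSphereProd E) := Homeomorph.measurableEmbedding _
  have hx : ∀ x : ({0}ᶜ : Set E), G (((homeomorphUnitSphereProd E x).2 : ℝ) •
      ((homeomorphUnitSphereProd E x).1 : E)) = G x := by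
    intro x
    have h : ((homeomorphUnitSphereProd E).symm (homeomorphUnitSphereProd E x) : E) = x := by simp
    rw [homeomorphUnitSphereProd_symm_apply_coe] at h
    rw [h]
  have hi : Integrable (fun q : Metric.sphere (0 : E) 1 × Set.Ioi (0 : ℝ) =>
      G ((q.2 : ℝ) • (q.1 : E)))
      (μ.toSphere.prod (Measure.volumeIoiPow (Module.finrank ℝ E - 1))) := by
    rw [← hmp.integrable_comp_emb hme]
    simp only [Function.comp_def, hx]
    have h := (hG.restrict (s := ({0}ᶜ : Set E)))
    exact (integrableOn_iff_comap_subtypeVal (measurableSet_singleton (0 : E)).compl).1 h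
  calc ∫ x, G x ∂μ = ∫ x : ({(0)}ᶜ : Set E), G x.1 ∂(μ.comap (↑)) := by
        rw [integral_subtype_comap (measurableSet_singleton _).compl fun x => G x,
          restrict_compl_singleton]
    _ = ∫ q : Metric.sphere (0 : E) 1 × Set.Ioi (0 : ℝ), G ((q.2 : ℝ) • (q.1 : E))
          ∂(μ.toSphere.prod (Measure.volumeIoiPow (Module.finrank ℝ E - 1))) := by
        rw [← hmp.integral_comp hme]
        simp only [hx]
    _ = _ := by
        rw [integral_prod _ hi]
        refine integral_congr_ae (Filter.Eventually.of_forall fun s => ?_)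
        exact integral_volumeIoiPow _ fun r => G (r • (s : E))

/-- If the radial integrals of `G` agree with those of `c φ(‖·‖)` then so do the integrals. -/
theorem integral_eq_of_radial [Nontrivial E] {G : E → ℂ} (hG : Integrable G μ) {φ : ℝ → ℝ}
    (hφ : Integrable (fun x : E => φ ‖x‖) μ) (c : ℂ)
    (h : ∀ s : E, ‖s‖ = 1 → ∫ r in Set.Ioi (0 : ℝ),
      ((r ^ (Module.finrank ℝ E - 1) : ℝ) : ℂ) * G (r • s) =
      c * (∫ r in Set.Ioi (0 : ℝ), r ^ (Module.finrank ℝ E - 1) * φ r : ℝ)) :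
    ∫ x, G x ∂μ = c * (∫ x, φ ‖x‖ ∂μ : ℝ) := by
  have hφ' : Integrable (fun x => c * ((φ ‖x‖ : ℝ) : ℂ)) μ := hφ.ofReal.const_mul c
  rw [← integral_complex_ofReal, ← integral_const_mul, integral_eq_integral_sphere μ hG,
    integral_eq_integral_sphere μ hφ']
  refine integral_congr_ae (Filter.Eventually.of_forall fun s => ?_)
  have hs : ‖(s : E)‖ = 1 := by simp
  change _ = ∫ r in Set.Ioi (0 : ℝ), ((r ^ (Module.finrank ℝ E - 1) : ℝ) : ℂ) *
    (c * ((φ ‖r • (s : E)‖ : ℝ) : ℂ))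
  refine (h s hs).trans ?_
  rw [← integral_complex_ofReal, ← integral_const_mul]
  refine setIntegral_congr_fun measurableSet_Ioi fun r (hr : 0 < r) => ?_
  simp only [norm_smul, hs, mul_one, Real.norm_of_nonneg hr.le]
  push_cast
  ring

end Polar

/-- Multiplication by a complex number of modulus one. -/
def unitSMul {n : ℕ} (c : ℂ) (hc : ‖c‖ = 1) : Cn n ≃ₗᵢ[ℝ] Cn n where
  toLinearEquiv := (LinearEquiv.smulOfNeZero ℂ (Cn n) c
    (by rintro rfl; simp at hc)).restrictScalars ℝ
  norm_map' x := by simp [norm_smul, hc]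

theorem measurePreserving_unit_smul {n : ℕ} (c : ℂ) (hc : ‖c‖ = 1) :
    MeasurePreserving (fun w : Cn n => c • w) volume volume :=
  (unitSMul c hc).measurePreserving

/-- `(θ, w) ↦ (θ, e^{iθ} w)` is a measure-preserving skew product; this joint integrability is what
Fubini needs for circular means. -/
theorem integrable_circle_prod {n : ℕ} {G : Cn n → ℂ} (hG : Integrable G) :
    Integrable (fun q : ℝ × Cn n => G (circleMap 0 1 q.1 • q.2))
      ((volume.restrict (Set.Ioc 0 (2 * Real.pi))).prod volume) := by
  have hm : MeasurePreserving (fun q : ℝ × Cn n => (q.1, circleMap 0 1 q.1 • q.2))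
      ((volume.restrict (Set.Ioc 0 (2 * Real.pi))).prod volume)
      ((volume.restrict (Set.Ioc 0 (2 * Real.pi))).prod volume) := by
    refine (MeasurePreserving.id _).skew_product (g := fun θ w => circleMap 0 1 θ • w) ?_ ?_
    · exact (((continuous_circleMap 0 1).comp continuous_fst).smul continuous_snd).measurable
    · exact Filter.Eventually.of_forall fun θ =>
        (measurePreserving_unit_smul _ (by simp)).map_eq
  exact hm.integrable_comp_of_integrable (hG.comp_snd _)

theorem integral_circleAverage {n : ℕ} {G : Cn n → ℂ} (hG : Integrable G) :
    Integrable (fun w => Real.circleAverage (fun t => G (t • w)) 0 1) ∧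
      ∫ w, Real.circleAverage (fun t => G (t • w)) 0 1 = ∫ w, G w := by
  have hi := integrable_circle_prod hG
  have h2pi : (0 : ℝ) ≤ 2 * Real.pi := by positivity
  have e : ∀ w, Real.circleAverage (fun t => G (t • w)) 0 1 =
      (2 * Real.pi)⁻¹ • ∫ θ in Set.Ioc 0 (2 * Real.pi), G (circleMap 0 1 θ • w) := by
    intro w
    rw [Real.circleAverage_def, intervalIntegral.integral_of_le h2pi]
  simp only [e]
  refine ⟨hi.integral_prod_right.smul (2 * Real.pi)⁻¹, ?_⟩
  rw [integral_smul, ← integral_integral_swap (f := fun θ w => G (circleMap 0 1 θ • w)) hi]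
  have e2 : ∀ θ : ℝ, ∫ w, G (circleMap 0 1 θ • w) = ∫ w, G w := fun θ =>
    (measurePreserving_unit_smul (circleMap 0 1 θ) (by simp)).integral_comp
      (unitSMul (circleMap 0 1 θ) (by simp)).toHomeomorph.measurableEmbedding G
  simp only [e2]
  rw [integral_const]
  have hpi : (Real.pi : ℂ) ≠ 0 := by exact_mod_cast Real.pi_ne_zero
  simp [h2pi]
  field_simp

/-! ### The reproducing formula -/

theorem finrank_Cn (n : ℕ) : Module.finrank ℝ (Cn n) = 2 * n := by
  rw [finrank_real_of_complex, finrank_euclideanSpace, Fintype.card_fin]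

theorem integrable_exp_neg_mul_sq_norm (n : ℕ) {α : ℝ} (hα : 0 < α) :
    Integrable (fun w : Cn n => Real.exp (-α * ‖w‖ ^ 2)) := by
  have h := (GaussianFourier.integrable_cexp_neg_mul_sq_norm_add (b := α) (V := Cn n)
    (by simpa using hα) 0 0).norm
  refine h.congr (Filter.Eventually.of_forall fun w => ?_)
  simp only [Complex.norm_exp]
  congr 1
  simp [← ofReal_pow]

theorem integral_exp_neg_mul_sq_norm (n : ℕ) {α : ℝ} (hα : 0 < α) :
    ∫ w : Cn n, Real.exp (-α * ‖w‖ ^ 2) = (Real.pi / α) ^ n := by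
  rw [GaussianFourier.integral_rexp_neg_mul_sq_norm hα, finrank_Cn]
  push_cast
  rw [mul_div_cancel_left₀ _ (two_ne_zero), Real.rpow_natCast]

/-- The weight is radial, so `f` may be replaced by its circular means. Along each ray these are `∑
c_j r^{2j}` with `j ≤ p` and `c_0 = f 0`, and orthogonality kills every `j ≥ 1`. -/
theorem integral_mAnalytic_mul_laguerre {ν p : ℕ} {α : ℝ} (hα : 0 < α)
    {f : Cn (ν + 1) → ℂ} (hf : IsMAnalytic (p + 1) f)
    (hi : Integrable fun w : Cn (ν + 1) => f w *
      ((laguerre (ν + 1) p (α * ‖w‖ ^ 2) * Real.exp (-α * ‖w‖ ^ 2) : ℝ) : ℂ)) :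
    ∫ w : Cn (ν + 1), f w *
      ((laguerre (ν + 1) p (α * ‖w‖ ^ 2) * Real.exp (-α * ‖w‖ ^ 2) : ℝ) : ℂ) =
      f 0 * (∫ w : Cn (ν + 1), Real.exp (-α * ‖w‖ ^ 2) : ℝ) := by
  obtain ⟨hi', e⟩ := integral_circleAverage hi
  rw [← e]
  refine integral_eq_of_radial volume hi' (φ := fun r => Real.exp (-α * r ^ 2))
    (integrable_exp_neg_mul_sq_norm _ hα) (f 0) fun s hs => ?_
  obtain ⟨c, hc0, hc⟩ := exists_circleAverage_eq p (slice_contDiff hf.1 s) (hf.slice s)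
  have hdim : Module.finrank ℝ (Cn (ν + 1)) - 1 = 2 * ν + 1 := by rw [finrank_Cn]; omega
  rw [hdim]
  have key : ∀ r ∈ Set.Ioi (0 : ℝ), ((r ^ (2 * ν + 1) : ℝ) : ℂ) *
      Real.circleAverage (fun t : ℂ => f (t • r • s) *
        ((laguerre (ν + 1) p (α * ‖t • r • s‖ ^ 2) *
          Real.exp (-α * ‖t • r • s‖ ^ 2) : ℝ) : ℂ)) 0 1 =
      ∑ j ∈ Finset.range (p + 1), c j * ((r ^ (2 * ν + 1) * (r ^ (2 * j) *
        (laguerre (ν + 1) p (α * r ^ 2) * Real.exp (-α * r ^ 2))) : ℝ) : ℂ) := by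
    intro r (hr : 0 < r)
    have h1 : Real.circleAverage (fun t : ℂ => f (t • r • s) *
        ((laguerre (ν + 1) p (α * ‖t • r • s‖ ^ 2) *
          Real.exp (-α * ‖t • r • s‖ ^ 2) : ℝ) : ℂ)) 0 1 =
        Real.circleAverage (fun t : ℂ => f (t • s)) 0 r *
          ((laguerre (ν + 1) p (α * r ^ 2) * Real.exp (-α * r ^ 2) : ℝ) : ℂ) := by
      rw [Real.circleAverage_def, Real.circleAverage_def, smul_mul_assoc,
        ← intervalIntegral.integral_mul_const]
      congr 1
      refine intervalIntegral.integral_congr fun θ _ => ?_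
      -- The unit circle through `r • s` is the circle of radius `r` in the slice along `s`; the
      -- radial factor is constant on it.
      have h2 : circleMap 0 1 θ • r • s = circleMap 0 r θ • s := by
        rw [← Complex.coe_smul, smul_smul]
        congr 1
        simp [circleMap, mul_comm]
      have h3 : ‖circleMap 0 r θ • s‖ = r := by
        rw [norm_smul, hs, mul_one]
        simp [abs_of_pos hr]
      simp only [h2, h3]
    rw [h1, hc r hr, Finset.sum_mul, Finset.mul_sum]
    refine Finset.sum_congr rfl fun j _ => ?_
    push_cast
    ring
  rw [setIntegral_congr_fun measurableSet_Ioi key, integral_finsetSum]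
  · rw [Finset.sum_eq_single 0]
    · rw [integral_const_mul, integral_complex_ofReal, integral_pow_mul_laguerre hα _ _ _ (by omega),
        if_pos rfl, hc0, zero_smul]
    · intro j hj hj0
      rw [integral_const_mul, integral_complex_ofReal, integral_pow_mul_laguerre hα _ _ _
        (by simpa [Nat.lt_succ_iff] using hj), if_neg hj0, ofReal_zero, mul_zero]
    · simp
  · exact fun j _ => (integrableOn_pow_mul_laguerre hα ν p j).ofReal.const_mul _

/-- The pairing `⟨w, z⟩ = ∑ w_r conj(z_r)`. -/
def pairing {n : ℕ} (w z : Cn n) : ℂ := ∑ r, w r * (starRingEnd ℂ) (z r)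

/-- The function `K_z(w) = exp(α ⟨w, z⟩) L_{m-1}^{(n)}(α |w - z|²)`. -/
def polyKernel (n m : ℕ) (α : ℝ) (z w : Cn n) : ℂ :=
  Complex.exp (α * pairing w z) * (laguerre n (m - 1) (α * ‖w - z‖ ^ 2) : ℂ)

theorem conj_pairing {n : ℕ} (w z : Cn n) : (starRingEnd ℂ) (pairing w z) = pairing z w := by
  simp [pairing, mul_comm]

theorem pairing_self {n : ℕ} (w : Cn n) : pairing w w = ((‖w‖ ^ 2 : ℝ) : ℂ) := by
  simpa [pairing] using (sq_norm_sub_eq w 0).symm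

theorem pairing_sub_left {n : ℕ} (u w z : Cn n) :
    pairing (u - w) z = pairing u z - pairing w z := by
  simp [pairing, sub_mul, Finset.sum_sub_distrib]

theorem pairing_sub_right {n : ℕ} (u w z : Cn n) :
    pairing u (w - z) = pairing u w - pairing u z := by
  simp [pairing, mul_sub, Finset.sum_sub_distrib]

theorem conj_polyKernel {n m : ℕ} {α : ℝ} (z w : Cn n) :
    (starRingEnd ℂ) (polyKernel n m α z w) = polyKernel n m α w z := by
  rw [polyKernel, polyKernel, map_mul, ← Complex.exp_conj, map_mul, conj_ofReal, conj_ofReal,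
    conj_pairing, norm_sub_rev]

theorem contDiff_exp_pairing {n : ℕ} (c : ℂ) (z : Cn n) :
    ContDiff ℝ ∞ (fun w => Complex.exp (c * pairing w z)) := by
  have h : ContDiff ℝ ∞ (fun w : Cn n => pairing w z) := by
    unfold pairing
    exact ContDiff.sum fun r _ => (contDiff_coord r).mul contDiff_const
  exact Complex.contDiff_exp.comp (contDiff_const.mul h)

theorem differentiable_exp_pairing {n : ℕ} (c : ℂ) (z : Cn n) :
    Differentiable ℂ (fun w => Complex.exp (c * pairing w z)) := by
  have h : Differentiable ℂ (fun w : Cn n => pairing w z) := by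
    unfold pairing
    exact Differentiable.fun_sum fun r _ => (differentiable_coord r).mul_const _
  exact (h.const_mul c).cexp

theorem integrable_gaussMeasure_iff {n : ℕ} {α : ℝ} (hα : 0 < α) {f : Cn n → ℂ} :
    Integrable f (gaussMeasure n α) ↔
      Integrable fun w => f w * (Real.exp (-α * ‖w‖ ^ 2) : ℂ) := by
  have hmeas : Measurable fun z : Cn n => ENNReal.ofReal (gaussWeight n α z) :=
    (ENNReal.continuous_ofReal.comp gaussWeight_continuous).measurable
  rw [gaussMeasure, integrable_withDensity_iff_integrable_smul' hmeas
    (Filter.Eventually.of_forall fun z => by simp)]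
  have hc : (((α ^ n / Real.pi ^ n : ℝ) : ℂ)) ≠ 0 := by
    have := Real.pi_pos
    exact_mod_cast (by positivity : α ^ n / Real.pi ^ n ≠ 0)
  rw [← integrable_const_mul_iff hc.isUnit (f := fun w => f w * (Real.exp (-α * ‖w‖ ^ 2) : ℂ))]
  refine integrable_congr (Filter.Eventually.of_forall fun z => ?_)
  simp only [ENNReal.toReal_ofReal (gaussWeight_pos hα z).le, Complex.real_smul]
  simp only [gaussWeight, Complex.ofReal_mul]
  ring

/-- The reproducing formula for `m`-analytic functions. -/
theorem IsMAnalytic.eq_integral_polyKernel {n m : ℕ} (hn : 1 ≤ n) (hm : 1 ≤ m) {α : ℝ}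
    (hα : 0 < α) {f : Cn n → ℂ} (hf : IsMAnalytic m f) (z : Cn n)
    (hi : Integrable (fun w => (starRingEnd ℂ) (polyKernel n m α z w) * f w)
      (gaussMeasure n α)) :
    ∫ w, (starRingEnd ℂ) (polyKernel n m α z w) * f w ∂gaussMeasure n α = f z := by
  obtain ⟨ν, rfl⟩ : ∃ ν, n = ν + 1 := ⟨n - 1, by omega⟩
  obtain ⟨p, rfl⟩ : ∃ p, m = p + 1 := ⟨m - 1, by omega⟩
  rw [integrable_gaussMeasure_iff hα] at hi
  rw [integral_gaussMeasure hα]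
  -- A weighted translation moves `z` to the origin. The exponential is holomorphic in `w`, so the
  -- order is preserved, and it equals `1` at `w = 0`.
  set h : Cn (ν + 1) → ℂ := (fun w => Complex.exp (-α * pairing w z)) * fun w => f (w + z) with hh
  have hh1 : IsMAnalytic (p + 1) h := IsMAnalytic.holomorphic_mul (contDiff_exp_pairing _ z)
    (differentiable_exp_pairing _ z) (hf.comp_add_right z)
  set G : Cn (ν + 1) → ℂ := fun w => h w *
      ((laguerre (ν + 1) p (α * ‖w‖ ^ 2) * Real.exp (-α * ‖w‖ ^ 2) : ℝ) : ℂ) with hG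
  have key : ∀ w, (starRingEnd ℂ) (polyKernel (ν + 1) (p + 1) α z w) * f w *
      (Real.exp (-α * ‖w‖ ^ 2) : ℂ) = G (w - z) := by
    intro w
    have e1 : ((‖w - z‖ ^ 2 : ℝ) : ℂ) =
        (‖w‖ ^ 2 : ℝ) - pairing w z - pairing z w + (‖z‖ ^ 2 : ℝ) := by
      rw [← pairing_self, pairing_sub_left, pairing_sub_right, pairing_sub_right, pairing_self,
        pairing_self]
      ring
    -- Expanding `|w - z|²` shows that the translated Gaussian with its holomorphic factor is the
    -- original Gaussian times the conjugated exponential of the kernel.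
    have e2 : Complex.exp (-α * pairing (w - z) z) * (Real.exp (-α * ‖w - z‖ ^ 2) : ℂ) =
        Complex.exp (α * pairing z w) * (Real.exp (-α * ‖w‖ ^ 2) : ℂ) := by
      rw [ofReal_exp, ofReal_exp, ← Complex.exp_add, ← Complex.exp_add, ofReal_mul, e1,
        pairing_sub_left, pairing_self, ofReal_mul]
      congr 1
      push_cast
      ring
    rw [conj_polyKernel, polyKernel, norm_sub_rev]
    simp only [hG, hh, Pi.mul_apply, sub_add_cancel, Nat.add_sub_cancel]
    rw [ofReal_mul]
    linear_combination (-(f w * (laguerre (ν + 1) p (α * ‖w - z‖ ^ 2) : ℂ))) * e2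
  simp only [key] at hi ⊢
  have hi' : Integrable G := by simpa using hi.comp_add_right z
  rw [integral_sub_right_eq_self G z, integral_mAnalytic_mul_laguerre hα hh1 hi',
    integral_exp_neg_mul_sq_norm _ hα]
  have h0 : h 0 = f z := by simp [hh, pairing]
  rw [h0]
  have hpi : (Real.pi : ℂ) ≠ 0 := by exact_mod_cast Real.pi_ne_zero
  have hα' : (α : ℂ) ≠ 0 := by exact_mod_cast hα.ne'
  push_cast
  rw [div_pow]
  field_simp

/-! ### Functions of exponential growth -/

/-- Functions bounded by `C exp(R |w|)`. -/
def ExpGrowth {n : ℕ} (g : Cn n → ℂ) : Prop :=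
  ∃ C R : ℝ, 0 ≤ C ∧ 0 ≤ R ∧ ∀ w, ‖g w‖ ≤ C * Real.exp (R * ‖w‖)

section Growth

variable {n : ℕ} {g h : Cn n → ℂ}

theorem ExpGrowth.mul (hg : ExpGrowth g) (hh : ExpGrowth h) :
    ExpGrowth (fun w => g w * h w) := by
  obtain ⟨C, R, hC, hR, hg⟩ := hg
  obtain ⟨C', R', hC', hR', hh⟩ := hh
  refine ⟨C * C', R + R', by positivity, by positivity, fun w => ?_⟩
  rw [norm_mul, add_mul, Real.exp_add]
  calc ‖g w‖ * ‖h w‖ ≤ (C * Real.exp (R * ‖w‖)) * (C' * Real.exp (R' * ‖w‖)) := by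
        gcongr
        · exact hg w
        · exact hh w
    _ = _ := by ring

theorem ExpGrowth.add (hg : ExpGrowth g) (hh : ExpGrowth h) :
    ExpGrowth (fun w => g w + h w) := by
  obtain ⟨C, R, hC, hR, hg⟩ := hg
  obtain ⟨C', R', hC', hR', hh⟩ := hh
  refine ⟨C + C', R + R', by positivity, by positivity, fun w => ?_⟩
  calc ‖g w + h w‖ ≤ ‖g w‖ + ‖h w‖ := norm_add_le _ _
    _ ≤ C * Real.exp (R * ‖w‖) + C' * Real.exp (R' * ‖w‖) := add_le_add (hg w) (hh w)
    _ ≤ C * Real.exp ((R + R') * ‖w‖) + C' * Real.exp ((R + R') * ‖w‖) := by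
        gcongr <;> linarith
    _ = _ := by ring

theorem expGrowth_const (c : ℂ) : ExpGrowth (fun _ : Cn n => c) :=
  ⟨‖c‖, 0, norm_nonneg c, le_rfl, fun w => by simp⟩

theorem expGrowth_sum {ι : Type*} (s : Finset ι) {f : ι → Cn n → ℂ}
    (hf : ∀ i ∈ s, ExpGrowth (f i)) : ExpGrowth (fun w => ∑ i ∈ s, f i w) := by
  classical
  induction s using Finset.induction_on with
  | empty => simpa using expGrowth_const 0
  | insert i s hi ih =>
    simp only [Finset.sum_insert hi]
    exact (hf i (by simp)).add (ih fun j hj => hf j (by simp [hj]))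

theorem ExpGrowth.pow (hg : ExpGrowth g) (i : ℕ) : ExpGrowth (fun w => g w ^ i) := by
  induction i with
  | zero => simpa using expGrowth_const 1
  | succ i ih =>
    simp only [pow_succ]
    exact ih.mul hg

theorem expGrowth_coord (r : Fin n) : ExpGrowth (fun w : Cn n => w r) :=
  ⟨1, 1, by simp, by simp, fun w => by
    rw [one_mul, one_mul]
    have h1 := PiLp.norm_apply_le w r
    have h2 := Real.add_one_le_exp ‖w‖
    linarith⟩

theorem expGrowth_conj_coord (r : Fin n) :
    ExpGrowth (fun w : Cn n => (starRingEnd ℂ) (w r)) := by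
  obtain ⟨C, R, hC, hR, h⟩ := expGrowth_coord (n := n) r
  exact ⟨C, R, hC, hR, fun w => by simpa using h w⟩

theorem expGrowth_sq_norm_sub (z : Cn n) :
    ExpGrowth (fun w : Cn n => ((‖w - z‖ ^ 2 : ℝ) : ℂ)) := by
  have h1 : ExpGrowth (fun w : Cn n => ((‖w - z‖ : ℝ) : ℂ)) := by
    refine ⟨Real.exp ‖z‖, 1, by positivity, by simp, fun w => ?_⟩
    rw [one_mul, ← Real.exp_add, norm_real, norm_norm]
    have h1 := norm_sub_le w z
    have h2 := Real.add_one_le_exp (‖z‖ + ‖w‖)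
    linarith
  simpa using h1.pow 2

theorem norm_pairing_le (w z : Cn n) : ‖pairing w z‖ ≤ ‖w‖ * ‖z‖ := by
  have h : pairing w z = inner ℂ z w := by
    simp [pairing, PiLp.inner_apply]
  rw [h, mul_comm]
  exact norm_inner_le_norm z w

theorem norm_exp_pairing_le {α : ℝ} (hα : 0 < α) (w z : Cn n) :
    ‖Complex.exp (α * pairing w z)‖ ≤ Real.exp (α * ‖z‖ * ‖w‖) := by
  rw [Complex.norm_exp, Real.exp_le_exp]
  have h1 := (Complex.re_le_norm (pairing w z)).trans (norm_pairing_le w z)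
  have h2 : ((α : ℂ) * pairing w z).re = α * (pairing w z).re := by simp
  rw [h2, mul_assoc, mul_comm ‖z‖]
  gcongr

theorem expGrowth_exp_pairing {α : ℝ} (hα : 0 < α) (z : Cn n) :
    ExpGrowth (fun w : Cn n => Complex.exp (α * pairing w z)) :=
  ⟨1, α * ‖z‖, by simp, by positivity, fun w => by
    rw [one_mul]; exact norm_exp_pairing_le hα w z⟩

theorem integrable_exp_mul_norm {α : ℝ} (hα : 0 < α) (R : ℝ) :
    Integrable (fun w : Cn n => Real.exp (R * ‖w‖)) (gaussMeasure n α) := by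
  have h : Integrable (fun w : Cn n => ((Real.exp (R * ‖w‖) : ℝ) : ℂ)) (gaussMeasure n α) := by
    rw [integrable_gaussMeasure_iff hα]
    refine ((integrable_exp_neg_mul_sq_norm n (half_pos hα)).const_mul
      (Real.exp (R ^ 2 / (2 * α)))).mono' ?_ (Filter.Eventually.of_forall fun w => ?_)
    · exact Continuous.aestronglyMeasurable (by fun_prop)
    · rw [← ofReal_mul, norm_real, Real.norm_of_nonneg (by positivity), ← Real.exp_add,
        ← Real.exp_add, Real.exp_le_exp]
      -- Completing the square bounds `R|w|` by `α|w|²/2 + R²/(2α)`, leaving half of the Gaussian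
      -- decay.
      have e : R ^ 2 / (2 * α) + -(α / 2) * ‖w‖ ^ 2 - (R * ‖w‖ + -α * ‖w‖ ^ 2) =
          (R - α * ‖w‖) ^ 2 / (2 * α) := by
        field_simp
        ring
      have : 0 ≤ (R - α * ‖w‖) ^ 2 / (2 * α) := by positivity
      linarith
  exact h.re.congr (Filter.Eventually.of_forall fun w => ofReal_re _)

theorem ExpGrowth.memLp {α : ℝ} (hα : 0 < α) (hg : ExpGrowth g) (hc : Continuous g) :
    MemLp g 2 (gaussMeasure n α) := by
  obtain ⟨C, R, hC, hR, hg⟩ := hg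
  rw [memLp_two_iff_integrable_sq_norm hc.aestronglyMeasurable]
  refine ((integrable_exp_mul_norm hα (2 * R)).const_mul (C ^ 2)).mono'
    (by fun_prop) (Filter.Eventually.of_forall fun w => ?_)
  rw [Real.norm_of_nonneg (by positivity)]
  calc ‖g w‖ ^ 2 ≤ (C * Real.exp (R * ‖w‖)) ^ 2 := by
        gcongr
        exact hg w
    _ = _ := by
        rw [mul_pow, ← Real.exp_nat_mul]
        congr 2
        push_cast
        ring

end Growth

/-! ### The kernel functions belong to the space -/

theorem laguerre_ofReal (a p : ℕ) (α x : ℝ) : ((laguerre a p (α * x) : ℝ) : ℂ) =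
    ∑ i ∈ Finset.range (p + 1),
      (((-1 : ℝ) ^ i * ((p + a).choose (p - i) : ℝ) * α ^ i / (i.factorial : ℝ) : ℝ) : ℂ) *
        (x : ℂ) ^ i := by
  rw [laguerre, ofReal_sum]
  refine Finset.sum_congr rfl fun i _ => ?_
  push_cast
  rw [mul_pow]
  ring

theorem isMAnalytic_sq_norm_sub_pow {n : ℕ} (z : Cn n) (i : ℕ) :
    IsMAnalytic (i + 1) (fun w : Cn n => ((‖w - z‖ ^ 2 : ℝ) : ℂ) ^ i) := by
  induction i with
  | zero =>
    simp only [pow_zero]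
    exact isMAnalytic_one contDiff_const (differentiable_const _)
  | succ i ih =>
    have e : (fun w : Cn n => ((‖w - z‖ ^ 2 : ℝ) : ℂ) ^ (i + 1)) =
        fun w => ((‖w - z‖ ^ 2 : ℝ) : ℂ) * ((‖w - z‖ ^ 2 : ℝ) : ℂ) ^ i :=
      funext fun w => pow_succ' _ _
    rw [e]
    exact ih.sq_norm_sub_mul z

/-- A polynomial of degree at most `m - 1` in `|w - z|²` has order `m`, and the exponential factor
is holomorphic in `w`. -/
theorem isMAnalytic_polyKernel {n m : ℕ} (hm : 1 ≤ m) (α : ℝ) (z : Cn n) :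
    IsMAnalytic m (polyKernel n m α z) := by
  have h : IsMAnalytic m (fun w : Cn n => ((laguerre n (m - 1) (α * ‖w - z‖ ^ 2) : ℝ) : ℂ)) := by
    have e : (fun w : Cn n => ((laguerre n (m - 1) (α * ‖w - z‖ ^ 2) : ℝ) : ℂ)) =
        ∑ i ∈ Finset.range (m - 1 + 1), (((-1 : ℝ) ^ i * ((m - 1 + n).choose (m - 1 - i) : ℝ) *
          α ^ i / (i.factorial : ℝ) : ℝ) : ℂ) • fun w : Cn n => ((‖w - z‖ ^ 2 : ℝ) : ℂ) ^ i := by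
      funext w
      simp only [laguerre_ofReal, Finset.sum_apply, Pi.smul_apply, smul_eq_mul]
    rw [e]
    refine IsMAnalytic.sum _ fun i hi => IsMAnalytic.smul
      ((isMAnalytic_sq_norm_sub_pow z i).mono ?_) _
    have := Finset.mem_range.1 hi
    omega
  exact IsMAnalytic.holomorphic_mul (contDiff_exp_pairing _ z) (differentiable_exp_pairing _ z) h

theorem expGrowth_polyKernel {n m : ℕ} {α : ℝ} (hα : 0 < α) (z : Cn n) :
    ExpGrowth (polyKernel n m α z) := by
  refine (expGrowth_exp_pairing hα z).mul ?_
  simp only [laguerre_ofReal]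
  exact expGrowth_sum _ fun i _ => (expGrowth_const _).mul ((expGrowth_sq_norm_sub z).pow i)

theorem polyKernel_memLp {n m : ℕ} (hm : 1 ≤ m) {α : ℝ} (hα : 0 < α) (z : Cn n) :
    MemLp (polyKernel n m α z) 2 (gaussMeasure n α) :=
  (expGrowth_polyKernel hα z).memLp hα (isMAnalytic_polyKernel hm α z).1.continuous

/-- The kernel function `K_z` as an element of the space. -/
def kernelElement {n m : ℕ} {α : ℝ} (hm : 1 ≤ m) (hα : 0 < α) (z : Cn n) : PolyFock n m α hα :=
  ⟨polyKernel n m α z, isMAnalytic_polyKernel hm α z, polyKernel_memLp hm hα z⟩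

theorem PolyFock.inner_eq_integral {n m : ℕ} {α : ℝ} {hα : 0 < α} (f g : PolyFock n m α hα) :
    inner ℂ f g = ∫ z, (starRingEnd ℂ) (f.toFun z) * g.toFun z ∂gaussMeasure n α := rfl

theorem inner_kernelElement {n m : ℕ} {α : ℝ} (hn : 1 ≤ n) (hm : 1 ≤ m) (hα : 0 < α) (z : Cn n)
    (f : PolyFock n m α hα) : inner ℂ (kernelElement hm hα z) f = f.toFun z := by
  rw [PolyFock.inner_eq_integral]
  exact IsMAnalytic.eq_integral_polyKernel hn hm hα f.property.1 z
    ((polyKernel_memLp hm hα z).star.integrable_mul f.memLp)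

/-! ### The integral transform with kernel `exp(α ⟨z, w⟩)` -/

/-- Functions that are integrable against every `exp(R |w|)` for the Gaussian measure. -/
def ExpIntegrable {n : ℕ} (α : ℝ) (q : Cn n → ℂ) : Prop :=
  AEStronglyMeasurable q (gaussMeasure n α) ∧
    ∀ R : ℝ, Integrable (fun w => Real.exp (R * ‖w‖) * ‖q w‖) (gaussMeasure n α)

section Transform

variable {n : ℕ} {α : ℝ}

/-- This stability lets the factors `w_r`, `w̄_r` and `exp(α⟨z, w⟩)` be absorbed into `q`, and so
permits repeated differentiation under the integral. -/
theorem ExpIntegrable.mul {q g : Cn n → ℂ} (hq : ExpIntegrable α q) (hg : ExpGrowth g)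
    (hc : Continuous g) : ExpIntegrable α (fun w => g w * q w) := by
  refine ⟨hc.aestronglyMeasurable.mul hq.1, fun R => ?_⟩
  obtain ⟨C, R', hC, hR', hg⟩ := hg
  refine ((hq.2 (R + R')).const_mul C).mono' ?_ (Filter.Eventually.of_forall fun w => ?_)
  · exact Continuous.aestronglyMeasurable (by fun_prop) |>.mul
      (hc.aestronglyMeasurable.mul hq.1).norm
  · rw [Real.norm_of_nonneg (by positivity), norm_mul, add_mul, Real.exp_add]
    calc Real.exp (R * ‖w‖) * (‖g w‖ * ‖q w‖)
        ≤ Real.exp (R * ‖w‖) * ((C * Real.exp (R' * ‖w‖)) * ‖q w‖) := by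
          gcongr
          exact hg w
      _ = _ := by ring

theorem ExpIntegrable.integrable {q : Cn n → ℂ} (hq : ExpIntegrable α q) :
    Integrable q (gaussMeasure n α) := by
  refine (hq.2 0).mono' hq.1 (Filter.Eventually.of_forall fun w => ?_)
  simp

theorem expIntegrable_of_memLp (hα : 0 < α) {q : Cn n → ℂ}
    (hq : MemLp q 2 (gaussMeasure n α)) : ExpIntegrable α q := by
  refine ⟨hq.1, fun R => ?_⟩
  have h : MemLp (fun w : Cn n => ((Real.exp (R * ‖w‖) : ℝ) : ℂ)) 2 (gaussMeasure n α) :=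
    ExpGrowth.memLp hα ⟨1, max R 0, by simp, by simp, fun w => by
      rw [norm_real, Real.norm_of_nonneg (by positivity), one_mul]
      gcongr
      exact le_max_left _ _⟩ (by fun_prop)
  refine (h.integrable_mul hq).norm.congr (Filter.Eventually.of_forall fun w => ?_)
  simp only [Pi.mul_apply]
  rw [norm_mul, norm_real, Real.norm_of_nonneg (by positivity)]

theorem pairing_continuous_right (z : Cn n) : Continuous fun w : Cn n => pairing z w := by
  unfold pairing
  exact continuous_finsetSum _ fun r _ => continuous_const.mul (contDiff_conj_coord r).continuous

theorem exp_pairing_continuous (z : Cn n) :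
    Continuous fun w : Cn n => Complex.exp (α * pairing z w) :=
  Complex.continuous_exp.comp (continuous_const.mul (pairing_continuous_right z))

theorem expGrowth_exp_pairing_right (hα : 0 < α) (z : Cn n) :
    ExpGrowth (fun w : Cn n => Complex.exp (α * pairing z w)) := by
  obtain ⟨C, R, hC, hR, h⟩ := expGrowth_exp_pairing hα z
  refine ⟨C, R, hC, hR, fun w => (le_of_eq ?_).trans (h w)⟩
  rw [Complex.norm_exp, Complex.norm_exp, ← conj_pairing w z]
  congr 1
  simp

/-- The transform `z ↦ ∫ q(w) exp(α ⟨z, w⟩) dγ(w)`. -/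
def expTransform (α : ℝ) (q : Cn n → ℂ) (z : Cn n) : ℂ :=
  ∫ w, Complex.exp (α * pairing z w) * q w ∂gaussMeasure n α

theorem conj_coord_mul_expIntegrable {q : Cn n → ℂ} (hq : ExpIntegrable α q) (r : Fin n) :
    ExpIntegrable α (fun w => (α * (starRingEnd ℂ) (w r)) * q w) :=
  hq.mul ((expGrowth_const _).mul (expGrowth_conj_coord r))
    (continuous_const.mul (contDiff_conj_coord r).continuous)

/-- Dominated differentiation on the unit ball around `z`, where `‖x‖ ≤ ‖z‖ + 1`. The partial
derivatives are transforms of the same type, with `q` multiplied by `α w̄_r`, so smoothness follows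
by induction over all `q`. -/
theorem hasFDerivAt_expTransform (hα : 0 < α) {q : Cn n → ℂ} (hq : ExpIntegrable α q)
    (z : Cn n) : HasFDerivAt (expTransform α q)
      (∑ r, expTransform α (fun w => (α * (starRingEnd ℂ) (w r)) * q w) z •
        (EuclideanSpace.proj r : Cn n →L[ℂ] ℂ)) z := by
  have hi : ∀ z, Integrable (fun w => Complex.exp (α * pairing z w) * q w) (gaussMeasure n α) :=
    fun z => (hq.mul (expGrowth_exp_pairing_right hα z) (exp_pairing_continuous z)).integrable
  have hi' : ∀ r z, Integrable (fun w => Complex.exp (α * pairing z w) *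
      ((α * (starRingEnd ℂ) (w r)) * q w)) (gaussMeasure n α) := fun r z =>
    ((conj_coord_mul_expIntegrable hq r).mul (expGrowth_exp_pairing_right hα z)
      (exp_pairing_continuous z)).integrable
  have hint : ∑ r, expTransform α (fun w => (α * (starRingEnd ℂ) (w r)) * q w) z •
        (EuclideanSpace.proj r : Cn n →L[ℂ] ℂ) =
      ∫ w, ∑ r, (Complex.exp (α * pairing z w) * ((α * (starRingEnd ℂ) (w r)) * q w)) •
        (EuclideanSpace.proj r : Cn n →L[ℂ] ℂ) ∂gaussMeasure n α := by
    rw [integral_finsetSum _ fun r _ => (hi' r z).smul_const _]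
    refine Finset.sum_congr rfl fun r _ => ?_
    rw [integral_smul_const]
    rfl
  rw [hint]
  refine hasFDerivAt_integral_of_dominated_of_fderiv_le
    (F' := fun z w => ∑ r, (Complex.exp (α * pairing z w) *
      ((α * (starRingEnd ℂ) (w r)) * q w)) • (EuclideanSpace.proj r : Cn n →L[ℂ] ℂ))
    (bound := fun w => ∑ r, (Real.exp ((α * (‖z‖ + 1)) * ‖w‖) *
      ‖(α * (starRingEnd ℂ) (w r)) * q w‖) * ‖(EuclideanSpace.proj r : Cn n →L[ℂ] ℂ)‖)
    (Metric.ball_mem_nhds z one_pos) (Filter.Eventually.of_forall fun x => (hi x).1) (hi z) ?_ ?_ ?_ ?_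
  · exact (integrable_finsetSum _ fun r _ => (hi' r z).smul_const
      (EuclideanSpace.proj r : Cn n →L[ℂ] ℂ)).1
  · refine Filter.Eventually.of_forall fun w x hx => ?_
    refine (norm_sum_le _ _).trans (Finset.sum_le_sum fun r _ => ?_)
    rw [norm_smul, norm_mul]
    gcongr
    have hx' : ‖x‖ ≤ ‖z‖ + 1 := by
      have h1 : ‖x - z‖ < 1 := by simpa [dist_eq_norm] using hx
      have h2 := norm_le_norm_add_norm_sub' x z
      linarith
    refine (norm_exp_pairing_le hα x w).trans ?_
    rw [Real.exp_le_exp, mul_assoc, mul_assoc, mul_comm ‖w‖]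
    gcongr
  · exact integrable_finsetSum _ fun r _ =>
      ((conj_coord_mul_expIntegrable hq r).2 _).mul_const _
  · refine Filter.Eventually.of_forall fun w x _ => ?_
    have h1 : HasFDerivAt (fun x : Cn n => pairing x w)
        (∑ r, (starRingEnd ℂ) (w r) • (EuclideanSpace.proj r : Cn n →L[ℂ] ℂ)) x := by
      unfold pairing
      exact HasFDerivAt.fun_sum fun r _ =>
        (EuclideanSpace.proj r : Cn n →L[ℂ] ℂ).hasFDerivAt.mul_const _
    refine (((h1.const_mul (α : ℂ)).cexp).mul_const (q w)).congr_fderiv ?_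
    ext v
    simp only [smul_apply, FunLike.coe_sum, Finset.sum_apply, smul_eq_mul,
      Finset.mul_sum]
    refine Finset.sum_congr rfl fun r _ => ?_
    ring

theorem contDiff_expTransform (hα : 0 < α) {q : Cn n → ℂ} (hq : ExpIntegrable α q) :
    ContDiff ℂ ∞ (expTransform α q) := by
  rw [contDiff_infty]
  intro k
  induction k generalizing q with
  | zero =>
    rw [Nat.cast_zero, contDiff_zero]
    exact continuous_iff_continuousAt.2 fun z => (hasFDerivAt_expTransform hα hq z).continuousAt
  | succ k ih =>
    rw [Nat.cast_succ, contDiff_succ_iff_fderiv]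
    refine ⟨fun z => (hasFDerivAt_expTransform hα hq z).differentiableAt,
      fun h => absurd h (by simp), ?_⟩
    have e : fderiv ℂ (expTransform α q) = fun z =>
        ∑ r, expTransform α (fun w => (α * (starRingEnd ℂ) (w r)) * q w) z •
          (EuclideanSpace.proj r : Cn n →L[ℂ] ℂ) :=
      funext fun z => (hasFDerivAt_expTransform hα hq z).fderiv
    rw [e]
    exact ContDiff.sum fun r _ => (ih (conj_coord_mul_expIntegrable hq r)).smul contDiff_const

theorem isMAnalytic_expTransform (hα : 0 < α) {q : Cn n → ℂ} (hq : ExpIntegrable α q) :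
    IsMAnalytic 1 (expTransform α q) :=
  isMAnalytic_one ((contDiff_expTransform hα hq).restrict_scalars ℝ)
    ((contDiff_expTransform hα hq).differentiable (by simp))

/-- The transform `z ↦ ∫ q(w) exp(α ⟨z, w⟩) |w - z|^{2i} dγ(w)`. -/
def sqTransform (α : ℝ) (i : ℕ) (q : Cn n → ℂ) (z : Cn n) : ℂ :=
  ∫ w, Complex.exp (α * pairing z w) * ((((‖w - z‖ ^ 2 : ℝ) : ℂ) ^ i) * q w) ∂gaussMeasure n α

theorem integrable_sqTransform (hα : 0 < α) (i : ℕ) {q : Cn n → ℂ} (hq : ExpIntegrable α q)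
    (z : Cn n) : Integrable (fun w => Complex.exp (α * pairing z w) *
      ((((‖w - z‖ ^ 2 : ℝ) : ℂ) ^ i) * q w)) (gaussMeasure n α) :=
  ((hq.mul ((expGrowth_sq_norm_sub z).pow i) (by fun_prop)).mul
    (expGrowth_exp_pairing_right hα z) (exp_pairing_continuous z)).integrable

/-- One factor `|w - z|²` is multiplied out: powers of `w_r`, `w̄_r` go into `q`, while `z_r`,
`z̄_r` leave the integral. Each term carries at most one `z̄_r`, so the order rises by one. -/
theorem sqTransform_succ (hα : 0 < α) (i : ℕ) {q : Cn n → ℂ} (hq : ExpIntegrable α q)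
    (h1 : ∀ r, ExpIntegrable α (fun w => w r * q w))
    (h2 : ∀ r, ExpIntegrable α (fun w => (starRingEnd ℂ) (w r) * q w))
    (h3 : ∀ r, ExpIntegrable α (fun w => (w r * (starRingEnd ℂ) (w r)) * q w)) :
    sqTransform α (i + 1) q = ∑ r,
      (sqTransform α i (fun w => (w r * (starRingEnd ℂ) (w r)) * q w) +
        (-1 : ℂ) • ((fun z : Cn n => (starRingEnd ℂ) (z r)) *
          sqTransform α i (fun w => w r * q w)) +
        (-1 : ℂ) • ((fun z : Cn n => z r) *
          sqTransform α i (fun w => (starRingEnd ℂ) (w r) * q w)) +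
        (fun z : Cn n => z r) * ((fun z : Cn n => (starRingEnd ℂ) (z r)) * sqTransform α i q)) := by
  funext z
  rw [Finset.sum_apply]
  have e : ∀ r, (sqTransform α i (fun w => (w r * (starRingEnd ℂ) (w r)) * q w) +
        (-1 : ℂ) • ((fun z : Cn n => (starRingEnd ℂ) (z r)) *
          sqTransform α i (fun w => w r * q w)) +
        (-1 : ℂ) • ((fun z : Cn n => z r) *
          sqTransform α i (fun w => (starRingEnd ℂ) (w r) * q w)) +
        (fun z : Cn n => z r) *
          ((fun z : Cn n => (starRingEnd ℂ) (z r)) * sqTransform α i q)) z =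
      ∫ w, Complex.exp (α * pairing z w) * ((((‖w - z‖ ^ 2 : ℝ) : ℂ) ^ i) *
        (((w r - z r) * ((starRingEnd ℂ) (w r) - (starRingEnd ℂ) (z r))) * q w))
        ∂gaussMeasure n α := by
    intro r
    have i1 := integrable_sqTransform hα i (h3 r) z
    have i2 := (integrable_sqTransform hα i (h1 r) z).const_mul (-(starRingEnd ℂ) (z r))
    have i3 := (integrable_sqTransform hα i (h2 r) z).const_mul (-(z r))
    have i4 := (integrable_sqTransform hα i hq z).const_mul (z r * (starRingEnd ℂ) (z r))
    have s : ∀ w, Complex.exp (α * pairing z w) * ((((‖w - z‖ ^ 2 : ℝ) : ℂ) ^ i) *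
        (((w r - z r) * ((starRingEnd ℂ) (w r) - (starRingEnd ℂ) (z r))) * q w)) =
        ((Complex.exp (α * pairing z w) * ((((‖w - z‖ ^ 2 : ℝ) : ℂ) ^ i) *
          ((w r * (starRingEnd ℂ) (w r)) * q w)) +
        (-(starRingEnd ℂ) (z r)) * (Complex.exp (α * pairing z w) *
          ((((‖w - z‖ ^ 2 : ℝ) : ℂ) ^ i) * (w r * q w)))) +
        (-(z r)) * (Complex.exp (α * pairing z w) *
          ((((‖w - z‖ ^ 2 : ℝ) : ℂ) ^ i) * ((starRingEnd ℂ) (w r) * q w)))) +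
        (z r * (starRingEnd ℂ) (z r)) * (Complex.exp (α * pairing z w) *
          ((((‖w - z‖ ^ 2 : ℝ) : ℂ) ^ i) * q w)) := fun w => by ring
    simp only [s]
    refine Eq.trans ?_ ((integral_add ((i1.add i2).add i3) i4).trans (congrArg (· + _)
      ((integral_add (i1.add i2) i3).trans (congrArg (· + _) (integral_add i1 i2))))).symm
    rw [integral_const_mul, integral_const_mul, integral_const_mul]
    simp only [Pi.add_apply, Pi.smul_apply, Pi.mul_apply, sqTransform, smul_eq_mul]
    ring
  simp only [e]
  rw [← integral_finsetSum]
  · refine integral_congr_ae (Filter.Eventually.of_forall fun w => ?_)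
    simp only [← Finset.mul_sum, ← Finset.sum_mul]
    rw [← sq_norm_sub_eq, pow_succ]
    ring
  · intro r _
    refine integrable_sqTransform hα i (hq.mul (g := fun w => (w r - z r) *
      ((starRingEnd ℂ) (w r) - (starRingEnd ℂ) (z r))) ?_ ?_) z
    · simp only [sub_eq_add_neg]
      exact ((expGrowth_coord r).add (expGrowth_const _)).mul
        ((expGrowth_conj_coord r).add (expGrowth_const _))
    · exact ((contDiff_coord r).continuous.sub continuous_const).mul
        ((contDiff_conj_coord r).continuous.sub continuous_const)

theorem isMAnalytic_sqTransform (hα : 0 < α) (i : ℕ) {q : Cn n → ℂ} (hq : ExpIntegrable α q) :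
    IsMAnalytic (i + 1) (sqTransform α i q) := by
  induction i generalizing q with
  | zero =>
    have e : sqTransform α 0 q = expTransform α q := by
      funext z
      simp [sqTransform, expTransform]
    rw [e]
    exact isMAnalytic_expTransform hα hq
  | succ i ih =>
    have h1 : ∀ r, ExpIntegrable α (fun w => w r * q w) := fun r =>
      hq.mul (expGrowth_coord r) (contDiff_coord r).continuous
    have h2 : ∀ r, ExpIntegrable α (fun w => (starRingEnd ℂ) (w r) * q w) := fun r =>
      hq.mul (expGrowth_conj_coord r) (contDiff_conj_coord r).continuous
    have h3 : ∀ r, ExpIntegrable α (fun w => (w r * (starRingEnd ℂ) (w r)) * q w) := fun r =>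
      hq.mul ((expGrowth_coord r).mul (expGrowth_conj_coord r))
        ((contDiff_coord r).continuous.mul (contDiff_conj_coord r).continuous)
    rw [sqTransform_succ hα i hq h1 h2 h3]
    refine IsMAnalytic.sum _ fun r _ => (((ih (h3 r)).succ.add
      (((ih (h1 r)).conj_coord_mul r).smul _)).add (IsMAnalytic.smul ?_ _)).add ?_
    · exact IsMAnalytic.holomorphic_mul (contDiff_coord r) (differentiable_coord r) (ih (h2 r)).succ
    · exact IsMAnalytic.holomorphic_mul (contDiff_coord r) (differentiable_coord r)
        ((ih hq).conj_coord_mul r)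

/-- The projection `z ↦ ⟨K_z, q⟩` produces `m`-analytic functions. -/
theorem isMAnalytic_integral_polyKernel {m : ℕ} (hm : 1 ≤ m) (hα : 0 < α) {q : Cn n → ℂ}
    (hq : ExpIntegrable α q) : IsMAnalytic m (fun z =>
      ∫ w, (starRingEnd ℂ) (polyKernel n m α z w) * q w ∂gaussMeasure n α) := by
  have e : (fun z => ∫ w, (starRingEnd ℂ) (polyKernel n m α z w) * q w ∂gaussMeasure n α) =
      ∑ i ∈ Finset.range (m - 1 + 1), (((-1 : ℝ) ^ i * ((m - 1 + n).choose (m - 1 - i) : ℝ) *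
        α ^ i / (i.factorial : ℝ) : ℝ) : ℂ) • sqTransform α i q := by
    funext z
    rw [Finset.sum_apply]
    simp only [Pi.smul_apply, smul_eq_mul, sqTransform, ← integral_const_mul]
    rw [← integral_finsetSum _ fun i _ => (integrable_sqTransform hα i hq z).const_mul _]
    refine integral_congr_ae (Filter.Eventually.of_forall fun w => ?_)
    -- Conjugating the kernel exchanges its variables, so the exponential becomes holomorphic in
    -- `z`.
    simp only [conj_polyKernel]
    rw [polyKernel, norm_sub_rev, laguerre_ofReal, Finset.mul_sum, Finset.sum_mul]
    exact Finset.sum_congr rfl fun i _ => by ring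
  rw [e]
  refine IsMAnalytic.sum _ fun i hi => IsMAnalytic.smul
    ((isMAnalytic_sqTransform hα i hq).mono ?_) _
  have := Finset.mem_range.1 hi
  omega

end Transform

/-! ### Completeness -/

/-- The isometric embedding of the space into `L²`. -/
def toL2 (n m : ℕ) (α : ℝ) (hα : 0 < α) :
    PolyFock n m α hα →ₗᵢ[ℂ] Lp ℂ 2 (gaussMeasure n α) :=
  LinearMap.isometryOfInner
    { toFun := fun f => f.memLp.toLp f.toFun
      map_add' := fun f g => MemLp.toLp_add f.memLp g.memLp
      map_smul' := fun c f => MemLp.toLp_const_smul c f.memLp } fun f g => by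
    rw [L2.inner_def, PolyFock.inner_eq_integral]
    refine integral_congr_ae ?_
    filter_upwards [f.memLp.coeFn_toLp, g.memLp.coeFn_toLp] with w h1 h2
    change inner ℂ ((f.memLp.toLp f.toFun : Cn n → ℂ) w) ((g.memLp.toLp g.toFun : Cn n → ℂ) w) = _
    rw [h1, h2]
    simp [mul_comm]

theorem coeFn_toL2 {n m : ℕ} {α : ℝ} {hα : 0 < α} (f : PolyFock n m α hα) :
    toL2 n m α hα f =ᵐ[gaussMeasure n α] f.toFun := f.memLp.coeFn_toLp

theorem inner_toL2_kernelElement {n m : ℕ} {α : ℝ} (hm : 1 ≤ m) (hα : 0 < α) (z : Cn n)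
    (φ : Lp ℂ 2 (gaussMeasure n α)) : inner ℂ (toL2 n m α hα (kernelElement hm hα z)) φ =
      ∫ w, (starRingEnd ℂ) (polyKernel n m α z w) * φ w ∂gaussMeasure n α := by
  rw [L2.inner_def]
  refine integral_congr_ae ?_
  filter_upwards [coeFn_toL2 (kernelElement hm hα z)] with w h1
  rw [h1, RCLike.inner_apply, mul_comm]
  rfl

-- A Cauchy sequence has an `L²` limit `φ`, and the task is to find an `m`-analytic representative.
-- Pairing `φ` with the kernel functions produces one, and continuity of the inner product gives
-- pointwise convergence to it.
open Filter Topology in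
theorem completeSpace_polyFock {n m : ℕ} (hn : 1 ≤ n) (hm : 1 ≤ m) {α : ℝ} (hα : 0 < α) :
    CompleteSpace (PolyFock n m α hα) := by
  refine Metric.complete_of_cauchySeq_tendsto fun u hu => ?_
  obtain ⟨φ, hφ⟩ : ∃ φ, Tendsto (fun k => toL2 n m α hα (u k)) atTop (𝓝 φ) :=
    cauchySeq_tendsto_of_complete
      ((toL2 n m α hα).isometry.uniformContinuous.comp_cauchySeq hu)
  set F : Cn n → ℂ := fun z =>
    ∫ w, (starRingEnd ℂ) (polyKernel n m α z w) * φ w ∂gaussMeasure n α with hF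
  have hFm : IsMAnalytic m F :=
    isMAnalytic_integral_polyKernel hm hα (expIntegrable_of_memLp hα (Lp.memLp φ))
  have hpt : ∀ z, Tendsto (fun k => (u k).toFun z) atTop (𝓝 (F z)) := by
    intro z
    have h1 : Tendsto (fun k => inner ℂ (toL2 n m α hα (kernelElement hm hα z))
        (toL2 n m α hα (u k))) atTop (𝓝 (F z)) := by
      rw [hF]
      simp only [← inner_toL2_kernelElement hm hα]
      exact tendsto_const_nhds.inner hφ
    simpa only [LinearIsometry.inner_map_map, inner_kernelElement hn] using h1
  -- A subsequence converges almost everywhere to `φ`, while the whole sequence converges pointwise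
  -- to `F`; uniqueness of limits identifies the two.
  obtain ⟨ns, hns, hae⟩ := (tendstoInMeasure_of_tendsto_Lp hφ).exists_seq_tendsto_ae
  have hFφ : φ =ᵐ[gaussMeasure n α] F := by
    have h2 : ∀ᵐ w ∂gaussMeasure n α, ∀ k, toL2 n m α hα (u k) w = (u k).toFun w :=
      ae_all_iff.2 fun k => coeFn_toL2 (u k)
    filter_upwards [hae, h2] with w hw1 hw2
    refine tendsto_nhds_unique hw1 ?_
    refine ((hpt w).comp hns.tendsto_atTop).congr fun k => ?_
    exact (hw2 (ns k)).symm
  have hFL : MemLp F 2 (gaussMeasure n α) := (memLp_congr_ae hFφ).1 (Lp.memLp φ)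
  set f : PolyFock n m α hα := ⟨F, hFm, hFL⟩
  have hf : toL2 n m α hα f = φ := Lp.ext ((coeFn_toL2 f).trans hFφ.symm)
  refine ⟨f, ?_⟩
  rw [(toL2 n m α hα).isometry.isUniformInducing.isInducing.tendsto_nhds_iff, hf]
  exact hφ

/-! ### The reproducing kernel -/

theorem PolyFock.toFun_injective {n m : ℕ} {α : ℝ} {hα : 0 < α} :
    Function.Injective (PolyFock.toFun : PolyFock n m α hα → Cn n → ℂ) :=
  Subtype.val_injective

/-- The reproducing kernel Hilbert space structure given by point evaluations. -/
@[reducible]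
def rkhsPolyFock {n m : ℕ} (hn : 1 ≤ n) (hm : 1 ≤ m) {α : ℝ} (hα : 0 < α) :
    RKHS ℂ (PolyFock n m α hα) (Cn n) ℂ where
  coeCLM := ContinuousLinearMap.pi fun z => innerSL ℂ (kernelElement hm hα z)
  coeCLM_injective f g h := PolyFock.toFun_injective (funext fun z => by
    simpa [inner_kernelElement hn] using congrFun h z)

theorem rkhsPolyFock_apply {n m : ℕ} (hn : 1 ≤ n) (hm : 1 ≤ m) {α : ℝ} (hα : 0 < α)
    (f : PolyFock n m α hα) (z : Cn n) :
    letI := rkhsPolyFock hn hm hα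
    RKHS.coeCLM ℂ f z = f.toFun z :=
  inner_kernelElement hn hm hα z f

theorem kerFun_eq_kernelElement {n m : ℕ} (hn : 1 ≤ n) (hm : 1 ≤ m) {α : ℝ} (hα : 0 < α)
    [CompleteSpace (PolyFock n m α hα)] (z : Cn n) :
    letI := rkhsPolyFock hn hm hα
    RKHS.kerFun (PolyFock n m α hα) z (1 : ℂ) = kernelElement hm hα z := by
  let _ := rkhsPolyFock hn hm hα
  refine ext_inner_right ℂ fun f => ?_
  rw [RKHS.kerFun_inner, inner_kernelElement hn]
  have h : f z = f.toFun z := rkhsPolyFock_apply hn hm hα f z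
  rw [h]
  simp

theorem kernel_eq_polyKernel {n m : ℕ} (hn : 1 ≤ n) (hm : 1 ≤ m) {α : ℝ} (hα : 0 < α)
    [CompleteSpace (PolyFock n m α hα)] (z w : Cn n) :
    letI := rkhsPolyFock hn hm hα
    RKHS.kernel (PolyFock n m α hα) w z 1 = polyKernel n m α z w := by
  let _ := rkhsPolyFock hn hm hα
  rw [← RKHS.kerFun_apply, kerFun_eq_kernelElement hn hm hα]
  exact rkhsPolyFock_apply hn hm hα _ w

/-- By reproduction `‖K_z‖² = K_z(z)`, and on the diagonal the Laguerre factor is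
`L_{m-1}^{(n)}(0)`, the cardinality of `J n m`. -/
theorem norm_kernelElement {n m : ℕ} (hn : 1 ≤ n) (hm : 1 ≤ m) {α : ℝ} (hα : 0 < α) (z : Cn n) :
    ‖kernelElement (n := n) hm hα z‖ = √((J n m).card : ℝ) * Real.exp (α / 2 * ‖z‖ ^ 2) := by
  obtain ⟨p, rfl⟩ : ∃ p, m = p + 1 := ⟨m - 1, by omega⟩
  have h : (inner ℂ (kernelElement (n := n) hm hα z) (kernelElement hm hα z)).re =
      Real.exp (α * ‖z‖ ^ 2) * (J n (p + 1)).card := by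
    rw [inner_kernelElement hn, card_J]
    change (polyKernel n (p + 1) α z z).re = _
    rw [polyKernel, pairing_self, sub_self, norm_zero]
    simp only [ne_eq, OfNat.ofNat_ne_zero, not_false_eq_true, zero_pow, mul_zero, laguerre_zero,
      Nat.add_sub_cancel]
    rw [← ofReal_mul, ← ofReal_exp, ← ofReal_mul, ofReal_re]
  rw [norm_eq_sqrt_re_inner (𝕜 := ℂ)]
  have h' : RCLike.re (inner ℂ (kernelElement (n := n) hm hα z) (kernelElement hm hα z)) =
      Real.exp (α * ‖z‖ ^ 2) * (J n (p + 1)).card := h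
  have e : Real.exp (α * ‖z‖ ^ 2) = Real.exp (α / 2 * ‖z‖ ^ 2) ^ 2 := by
    rw [← Real.exp_nat_mul]
    congr 1
    push_cast
    ring
  rw [h', mul_comm, Real.sqrt_mul (by positivity), e, Real.sqrt_sq (by positivity)]

/-! ### Product forms of the kernel and the main theorem -/

theorem polyKernel_eq_sum {n m : ℕ} (hm : 1 ≤ m) (α : ℝ) (z w : Cn n) :
    polyKernel n m α z w = ∑ k ∈ J n m, ∏ r,
      (Complex.exp ((α : ℂ) * (w r * (starRingEnd ℂ) (z r))) *
        (laguerre 0 (k r) (α * ‖w r - z r‖ ^ 2) : ℂ)) := by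
  obtain ⟨p, rfl⟩ : ∃ p, m = p + 1 := ⟨m - 1, by omega⟩
  have e : α * ‖w - z‖ ^ 2 = ∑ r, α * ‖w r - z r‖ ^ 2 := by
    rw [EuclideanSpace.norm_sq_eq, Finset.mul_sum]
    rfl
  simp only [Finset.prod_mul_distrib, ← Complex.exp_sum, ← Finset.mul_sum]
  rw [polyKernel, e, Nat.add_sub_cancel, ← sum_J_prod_laguerre]
  push_cast
  rfl

/-- Since `|a - b|² = |a|² + |b|² - 2 Re(a b̄)`, the factor `e^{-t/2}` in the Laguerre function
trades `Re(a b̄)` for `(|a|² + |b|²)/2` and leaves the phase `Im(a b̄)`. -/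
theorem exp_mul_laguerre_eq (α : ℝ) (k : ℕ) (a b : ℂ) :
    Complex.exp ((α : ℂ) * (a * (starRingEnd ℂ) b)) * (laguerre 0 k (α * ‖a - b‖ ^ 2) : ℂ) =
      Complex.exp ((α / 2 * (‖a‖ ^ 2 + ‖b‖ ^ 2) : ℝ) +
        Complex.I * ((α * (a * (starRingEnd ℂ) b).im : ℝ) : ℂ)) *
        (laguerreFun k (α * ‖a - b‖ ^ 2) : ℂ) := by
  have e : ‖a - b‖ ^ 2 = ‖a‖ ^ 2 + ‖b‖ ^ 2 - 2 * (a * (starRingEnd ℂ) b).re := by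
    rw [← Complex.normSq_eq_norm_sq, ← Complex.normSq_eq_norm_sq, ← Complex.normSq_eq_norm_sq,
      Complex.normSq_sub]
  have h : (laguerreFun k (α * ‖a - b‖ ^ 2) : ℂ) =
      Complex.exp ((-(1 / 2) * (α * ‖a - b‖ ^ 2) : ℝ) : ℂ) *
        (laguerre 0 k (α * ‖a - b‖ ^ 2) : ℂ) := by
    rw [laguerreFun, ofReal_mul, ofReal_exp]
  rw [h, ← mul_assoc (Complex.exp _), ← Complex.exp_add]
  congr 2
  conv_lhs => rw [← Complex.re_add_im (a * (starRingEnd ℂ) b)]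
  rw [e]
  push_cast
  ring

end PolyFockSpace

theorem mainTheorem7 (n m : ℕ) (hn : 1 ≤ n) (hm : 1 ≤ m) (α : ℝ) (hα : 0 < α) :
    ∃ (_ : CompleteSpace (PolyFockSpace.PolyFock n m α hα))
      (_ : RKHS ℂ (PolyFockSpace.PolyFock n m α hα) (PolyFockSpace.Cn n) ℂ),
      (∀ (f : PolyFockSpace.PolyFock n m α hα) (z : PolyFockSpace.Cn n),
        RKHS.coeCLM ℂ f z = f.toFun z) ∧
      (∀ z w : PolyFockSpace.Cn n,
        RKHS.kernel (PolyFockSpace.PolyFock n m α hα) w z 1 =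
          Complex.exp ((α : ℂ) * ∑ r, w r * (starRingEnd ℂ) (z r)) *
            (PolyFockSpace.laguerre n (m - 1) (α * ‖w - z‖ ^ 2) : ℂ)) ∧
      (PolyFockSpace.J n m).card = (n + m - 1).choose n ∧
      (∀ z : PolyFockSpace.Cn n,
        ‖RKHS.kerFun (PolyFockSpace.PolyFock n m α hα) z (1 : ℂ)‖ =
          √((PolyFockSpace.J n m).card : ℝ) * Real.exp (α / 2 * ‖z‖ ^ 2)) ∧
      (∀ z w : PolyFockSpace.Cn n,
        RKHS.kernel (PolyFockSpace.PolyFock n m α hα) w z 1 =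
          ∑ k ∈ PolyFockSpace.J n m, ∏ r,
            (Complex.exp ((α : ℂ) * (w r * (starRingEnd ℂ) (z r))) *
              (PolyFockSpace.laguerre 0 (k r) (α * ‖w r - z r‖ ^ 2) : ℂ))) ∧
      (∀ z w : PolyFockSpace.Cn n,
        RKHS.kernel (PolyFockSpace.PolyFock n m α hα) w z 1 =
          ∑ k ∈ PolyFockSpace.J n m, ∏ r,
            (Complex.exp ((α / 2 * (‖w r‖ ^ 2 + ‖z r‖ ^ 2) : ℝ) +
                Complex.I * ((α * (w r * (starRingEnd ℂ) (z r)).im : ℝ) : ℂ)) *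
              (PolyFockSpace.laguerreFun (k r) (α * ‖w r - z r‖ ^ 2) : ℂ))) := by
  refine ⟨PolyFockSpace.completeSpace_polyFock hn hm hα, PolyFockSpace.rkhsPolyFock hn hm hα,
    PolyFockSpace.rkhsPolyFock_apply hn hm hα, ?_, ?_, fun z => ?_, fun z w => ?_, fun z w => ?_⟩
  · exact fun z w => @PolyFockSpace.kernel_eq_polyKernel n m hn hm α hα
      (PolyFockSpace.completeSpace_polyFock hn hm hα) z w
  · obtain ⟨p, rfl⟩ : ∃ p, m = p + 1 := ⟨m - 1, by omega⟩
    rw [PolyFockSpace.card_J, show n + (p + 1) - 1 = p + n by omega, Nat.choose_symm_add]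
  · rw [← PolyFockSpace.norm_kernelElement hn hm hα z]
    exact congrArg _ (@PolyFockSpace.kerFun_eq_kernelElement n m hn hm α hα
      (PolyFockSpace.completeSpace_polyFock hn hm hα) z)
  · rw [← PolyFockSpace.polyKernel_eq_sum hm]
    exact @PolyFockSpace.kernel_eq_polyKernel n m hn hm α hα
      (PolyFockSpace.completeSpace_polyFock hn hm hα) z w
  · simp only [← PolyFockSpace.exp_mul_laguerre_eq]
    rw [← PolyFockSpace.polyKernel_eq_sum hm]
    exact @PolyFockSpace.kernel_eq_polyKernel n m hn hm α hα
      (PolyFockSpace.completeSpace_polyFock hn hm hα) z w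

end
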